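/- Let $\mathfrak g$ be a finite-dimensional semisimple real Lie algebra, $\theta$ a Cartan involution of $\mathfrak g$ with $-1$ eigenspace $\mathfrak p$, and $\mathfrak a$ a maximal abelian subalgebra contained in $\mathfrak p$. For a finite-dimensional real representation $\psi\colon\mathfrak g\to\mathfrak{gl}(V)$, the restricted weights of $\psi$ are the linear functionals $\chi$ on $\mathfrak a$ such that $\{v\in V:\psi(H)v=\chi(H)v\ \text{for all } H\in\mathfrak a\}\neq 0$; the set $\Sigma$ of restricted roots is the set of restricted weights of the adjoint representation, and $\mathfrak g^\zeta=\{X\in\mathfrak g:[H,X]=\zeta(H)X\ \text{for all } H\in\mathfrak a\}$. A restricted root $\zeta$ is called resonant with $\psi$ if $\zeta=c\chi$ for some $c>0$ and some restricted weight $\chi$ of $\psi$, and non-resonant otherwise; $\Sigma_{NR}$ is the set of non-resonant restricted roots. The representation $\psi$ is strongly non-resonant if every non-zero restricted root is non-resonant with $\psi$, and weakly non-resonant if $\mathfrak g^0\cup\bigcup_{\zeta\in\Sigma_{NR}}\mathfrak g^\zeta$ generates $\mathfrak g$ as a Lie algebra. The $\mathbb R$-rank of a semisimple real Lie algebra is the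 dimension of a maximal abelian subspace of the $-1$ eigenspace of a Cartan involution, and a simple real Lie algebra is compact if its Killing form is negative definite. Suppose that every non-compact simple factor (simple ideal) of $\mathfrak g$ has $\mathbb R$-rank at least $2$, and let $\psi$ be a finite-dimensional real representation of $\mathfrak g$ all of whose restricted weights are non-zero. Then $\psi$ is weakly non-resonant. Moreover, if no non-compact simple factor of $\mathfrak g$ has restricted root system of type $C_\ell$, $\ell\ge 2$ (where $C_2=B_2$), then $\psi$ is strongly non-resonant. -/

import Mathlib

namespace RestrictedRoots

section CartanInvolutions

variable {L : Type*} [LieRing L] [LieAlgebra ℝ L]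

/-- A Cartan involution of a real Lie algebra: an involutive automorphism `θ` for which the
symmetric bilinear form `(x, y) ↦ -B (x, θ y)` is positive definite, `B` the Killing form. -/
def IsCartanInvolution (θ : L →ₗ⁅ℝ⁆ L) : Prop :=
  (∀ x, θ (θ x) = x) ∧ ∀ x, x ≠ 0 → killingForm ℝ L x (θ x) < 0

/-- The subspace `𝔭`: the `-1` eigenspace of `θ`. -/
def pPart (θ : L →ₗ⁅ℝ⁆ L) : Submodule ℝ L :=
  Module.End.eigenspace (θ : L →ₗ[ℝ] L) (-1)

/-- `𝔞` is a maximal abelian subalgebra contained in `𝔭`. -/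
def IsMaximalAbelianIn (θ : L →ₗ⁅ℝ⁆ L) (𝔞 : LieSubalgebra ℝ L) : Prop :=
  Maximal (fun 𝔟 : LieSubalgebra ℝ L => IsLieAbelian 𝔟 ∧ 𝔟.toSubmodule ≤ pPart θ) 𝔞

variable (L) in
/-- A compact semisimple real Lie algebra: its Killing form is negative definite. -/
def IsCompactLieAlgebra : Prop :=
  ∀ x : L, x ≠ 0 → killingForm ℝ L x x < 0

variable (L) in
/-- The `ℝ`-rank of a semisimple real Lie algebra: the dimension of a maximal abelian subspace
`𝔞` of `𝔭`. For semisimple `L` all choices of `θ` and `𝔞` are conjugate, so that the set below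
is a singleton and `sInf` picks out its only element. -/
noncomputable def realRank : ℕ :=
  sInf {r | ∃ (θ : L →ₗ⁅ℝ⁆ L) (𝔞 : LieSubalgebra ℝ L),
    IsCartanInvolution θ ∧ IsMaximalAbelianIn θ 𝔞 ∧ Module.finrank ℝ 𝔞 = r}

end CartanInvolutions

section Weights

variable {L : Type*} [LieRing L] [LieAlgebra ℝ L] (𝔞 : LieSubalgebra ℝ L)
variable (V : Type*) [AddCommGroup V] [Module ℝ V] [LieRingModule L V] [LieModule ℝ L V]

/-- The restricted weight space `{v | ψ(H) v = χ(H) v for all H ∈ 𝔞}` of the representation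
`ψ = LieModule.toEnd ℝ L V` of `L` on `V`. -/
def weightSpace (χ : Module.Dual ℝ 𝔞) : Submodule ℝ V :=
  ⨅ H : 𝔞, Module.End.eigenspace (LieModule.toEnd ℝ L V (H : L)) (χ H)

/-- The restricted weights of `V` relative to `𝔞`. -/
def weights : Set (Module.Dual ℝ 𝔞) :=
  {χ | weightSpace 𝔞 V χ ≠ ⊥}

/-- The space `𝔤^ζ`; in particular `rootSpace 𝔞 0` is `𝔤^0`, the centralizer of `𝔞`. -/
def rootSpace (ζ : Module.Dual ℝ 𝔞) : Submodule ℝ L :=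
  weightSpace 𝔞 L ζ

/-- The restricted roots of `L` relative to `𝔞`: the restricted weights of the adjoint
representation (the trivial one, `0`, is among them). -/
def roots : Set (Module.Dual ℝ 𝔞) :=
  weights 𝔞 L

/-- `ζ` is resonant with `V`: it is a positive multiple of a restricted weight of `V`. -/
def IsResonant (ζ : Module.Dual ℝ 𝔞) : Prop :=
  ∃ c : ℝ, 0 < c ∧ ∃ χ ∈ weights 𝔞 V, ζ = c • χ

/-- The set `Σ_NR` of non-resonant restricted roots. -/
def nonresonantRoots : Set (Module.Dual ℝ 𝔞) :=
  {ζ ∈ roots 𝔞 | ¬ IsResonant 𝔞 V ζ}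

/-- Every non-trivial restricted root is non-resonant with `V`. -/
def StronglyNonresonant : Prop :=
  ∀ ζ ∈ roots 𝔞, ζ ≠ 0 → ¬ IsResonant 𝔞 V ζ

/-- `𝔤^0` and the root spaces of the non-resonant restricted roots generate `L` as a
Lie algebra. -/
def WeaklyNonresonant : Prop :=
  LieSubalgebra.lieSpan ℝ L
    ((rootSpace 𝔞 0 : Set L) ∪ ⋃ ζ ∈ nonresonantRoots 𝔞 V, (rootSpace 𝔞 ζ : Set L)) = ⊤

end Weights

section TypeC

/-- The root system `C_ℓ` in `ℝ^ℓ`: the vectors `± e_i ± e_j` with `i ≠ j`, and `± 2 e_i`. -/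
def rootSystemC (l : ℕ) : Set (Fin l → ℝ) :=
  {v | ∃ i j : Fin l, i ≠ j ∧ ∃ s t : ℝ, (s = 1 ∨ s = -1) ∧ (t = 1 ∨ t = -1) ∧
      v = Pi.single i s + Pi.single j t} ∪
  {v | ∃ i : Fin l, ∃ s : ℝ, (s = 1 ∨ s = -1) ∧ v = Pi.single i (2 * s)}

/-- The restricted root system of `L` is of type `C_ℓ` for some `ℓ ≥ 2`: the set of non-zero
restricted roots is carried to `C_ℓ` by a linear isomorphism of the ambient spaces (that is, by
an isomorphism of root systems). The root system `B_2`, being isomorphic to `C_2`, is included.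
For semisimple `L` this does not depend on the choice of `θ` and `𝔞`. -/
def HasTypeC (L : Type*) [LieRing L] [LieAlgebra ℝ L] : Prop :=
  ∃ (θ : L →ₗ⁅ℝ⁆ L) (𝔞 : LieSubalgebra ℝ L),
    IsCartanInvolution θ ∧ IsMaximalAbelianIn θ 𝔞 ∧
    ∃ l : ℕ, 2 ≤ l ∧ ∃ e : (Fin l → ℝ) ≃ₗ[ℝ] Module.Dual ℝ 𝔞,
      e '' rootSystemC l = roots 𝔞 \ {0}

end TypeC

end RestrictedRoots

/-!
Resonance is decided by `sl₂`-theory, and what remains is a statement about root systems.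

Every non-zero restricted root `β` has an `sl₂`-triple `(h, e, f)` with `h ∈ 𝔞` and `e ∈ 𝔤^β`,
`f ∈ 𝔤^(-β)` (`exists_isSl2Triple`). Hence the restricted weights of any finite-dimensional
representation contain, along with `χ`, the string of all `χ - k β` with `k` between `0` and the
integer `χ(h)` (`isStringClosed_weights`). No diagonalizability of `𝔞` on the representation is
needed for this. Let `ζ ≠ 0` be a restricted root equal to `c χ`, with `c > 0` and `χ` a weight of
`ψ`. The string of `ζ` through `χ` contains either `0` or `ζ / 2`; as `0` is not a weight, `ζ / 2`
is one (`mem_halvableRoots_of_eq_smul`). Call the roots `η` for which `η / 2` is a weight of `ψ`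
halvable. All the Cartan numbers `2 (η, β) / (β, β)` of a halvable root are even, and `η / 2` is not
a root. So a root `β ≠ ± η` that is not orthogonal to `η` has the Cartan numbers
`2 (η, β) / (β, β) = ± 2` and `2 (β, η) / (η, η) = ± 1` (`eq_or_eq_neg_or_exists_sign`).

For simple `𝔤` the roots are irreducible. If the rank is at least two, a halvable `ζ` is therefore a
sum of two roots `α` and `ζ - α`, neither of them halvable because of an odd Cartan number, while
`ζ + α` is not a root (`exists_sub_mem`). With an `sl₂`-triple for `α` this gives
`𝔤^ζ = [𝔤^α, 𝔤^(ζ - α)]`, and weak non-resonance follows (`weaklyNonresonant_of_isSimple`).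
Moreover distinct halvable roots are opposite or orthogonal, and reflections show that every root is
either halvable or half a sum of two orthogonal halvable roots. This is the root system `C_ℓ`, with
the halvable roots as its long roots (`exists_equiv_rootSystemC`).

In general, `θ` preserves each simple ideal `I`, and `𝔞` is compatible with the decomposition of `𝔤`
into `I` and its complement. The vectors of `V` killed by the part of `𝔞` in the complement form a
representation of `I` without weight zero, and a root of `I` that is resonant with `V` is resonant
with this representation (`isResonant_invariants`). This reduces both claims to the simple case.
The conditions on rank and type enter only through the Cartan involution and the abelian subalgebra
that `I` inherits, so the conjugacy of Cartan involutions is not used.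
-/

namespace RestrictedRoots

/-! ### Root systems with strings of weights -/

section Strings

variable {E : Type*} [AddCommGroup E] [Module ℝ E]

/-- `W` is closed under `Φ`-strings with respect to the bilinear form `B`: for `χ ∈ W` and `β ∈ Φ`
the Cartan number `n = 2 B(χ, β) / B(β, β)` is an integer, and all the vectors `χ - k β` with `k`
between `0` and `n` lie in `W`. -/
def IsStringClosed (B : LinearMap.BilinForm ℝ E) (Φ W : Set E) : Prop :=
  ∀ β ∈ Φ, ∀ χ ∈ W, ∃ n : ℤ, 2 * B χ β = n * B β β ∧
    ∀ k ∈ Set.uIcc 0 n, χ - (k : ℝ) • β ∈ W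

/-- The properties of the non-zero restricted roots of a simple Lie algebra: `Φ` is an irreducible,
possibly non-reduced, root system spanning `E`, for the inner product `B`. -/
structure IsIrreducibleRootSet (B : LinearMap.BilinForm ℝ E) (Φ : Set E) : Prop where
  symm : ∀ x y, B x y = B y x
  pos : ∀ x, x ≠ 0 → 0 < B x x
  zero_notMem : (0 : E) ∉ Φ
  string : IsStringClosed B Φ (insert 0 Φ)
  span_eq_top : Submodule.span ℝ Φ = ⊤
  eq_of_orthogonal : ∀ Ψ ⊆ Φ, Ψ.Nonempty → (∀ α ∈ Ψ, ∀ β ∈ Φ \ Ψ, B α β = 0) → Ψ = Φ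

/-- The roots one half of which belongs to `W`. -/
def halvableRoots (Φ W : Set E) : Set E :=
  {η ∈ Φ | (1 / 2 : ℝ) • η ∈ W}

variable {B : LinearMap.BilinForm ℝ E} {Φ W : Set E}

namespace IsIrreducibleRootSet

lemma ne_zero (hΦ : IsIrreducibleRootSet B Φ) {β : E} (hβ : β ∈ Φ) : β ≠ 0 := by
  rintro rfl
  exact hΦ.zero_notMem hβ

lemma pos_of_mem (hΦ : IsIrreducibleRootSet B Φ) {β : E} (hβ : β ∈ Φ) : 0 < B β β :=
  hΦ.pos β (hΦ.ne_zero hβ)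

lemma reflection_mem (hΦ : IsIrreducibleRootSet B Φ) {α β : E} (hα : α ∈ Φ) (hβ : β ∈ Φ) {r : ℝ}
    (h : 2 * B α β = r * B β β) : α - r • β ∈ Φ := by
  obtain ⟨n, hn, hs⟩ := hΦ.string β hβ α (Set.mem_insert_of_mem _ hα)
  have hp := hΦ.pos_of_mem hβ
  obtain rfl : r = n := by
    have : (r - n) * B β β = 0 := by linarith
    rcases mul_eq_zero.mp this with h | h <;> linarith
  rcases hs n (by simp) with h0 | h0
  · exfalso
    obtain rfl : α = (n : ℝ) • β := sub_eq_zero.mp h0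
    rw [map_smul, LinearMap.smul_apply, smul_eq_mul] at hn
    have : (n : ℝ) * B β β = 0 := by linarith
    rcases mul_eq_zero.mp this with h | h
    · exact hΦ.ne_zero hα (by rw [h, zero_smul])
    · linarith
  · exact h0

lemma neg_mem (hΦ : IsIrreducibleRootSet B Φ) {β : E} (hβ : β ∈ Φ) : -β ∈ Φ := by
  have := hΦ.reflection_mem hβ hβ (r := 2) rfl
  rwa [two_smul, sub_add_cancel_left] at this

/-- The Cauchy-Schwarz inequality and its equality case. -/
lemma sq_le_mul (hΦ : IsIrreducibleRootSet B Φ) (x : E) {y : E} (hy : y ≠ 0) :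
    (B x y) ^ 2 ≤ B x x * B y y ∧ ((B x y) ^ 2 = B x x * B y y → B y y • x = B x y • y) := by
  have hp := hΦ.pos y hy
  have key : B (B y y • x - B x y • y) (B y y • x - B x y • y)
      = B y y * (B x x * B y y - (B x y) ^ 2) := by
    simp only [map_sub, map_smul, LinearMap.sub_apply, LinearMap.smul_apply, smul_eq_mul,
      hΦ.symm y x]
    ring
  constructor
  · by_contra! h
    by_cases h0 : B y y • x - B x y • y = 0
    · rw [h0] at key
      simp only [map_zero, zero_eq_mul] at key
      rcases key with h | h <;> linarith
    · have := hΦ.pos _ h0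
      nlinarith
  · intro h
    by_contra h0
    have := hΦ.pos _ (sub_ne_zero.mpr h0)
    rw [key, h, sub_self, mul_zero] at this
    exact this.false

variable (hΦ : IsIrreducibleRootSet B Φ) (hW : IsStringClosed B Φ W) (h0 : (0 : E) ∉ W)
include hΦ hW

/-- A root which is a positive multiple of an element of `W` is twice an element of `W`: the string
through that element would otherwise contain `0`. -/
lemma mem_halvableRoots_of_eq_smul (h0 : (0 : E) ∉ W) {ζ χ : E} (hζ : ζ ∈ Φ) (hχ : χ ∈ W) {c : ℝ}
    (hc : 0 < c) (h : ζ = c • χ) : ζ ∈ halvableRoots Φ W := by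
  obtain ⟨n, hn, hs⟩ := hW ζ hζ χ hχ
  have hχ' : χ = c⁻¹ • ζ := by rw [h, smul_smul, inv_mul_cancel₀ hc.ne', one_smul]
  have hcn : (n : ℝ) = 2 * c⁻¹ := by
    have hp := hΦ.pos_of_mem hζ
    rw [hχ', map_smul, LinearMap.smul_apply, smul_eq_mul] at hn
    have : (n - 2 * c⁻¹ : ℝ) * B ζ ζ = 0 := by linarith
    rcases mul_eq_zero.mp this with h | h <;> linarith
  have hn0 : 0 < n := by
    have : (0 : ℝ) < n := by rw [hcn]; positivity
    exact_mod_cast this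
  have hc' : c⁻¹ = (n : ℝ) / 2 := by linarith
  obtain ⟨k, rfl | rfl⟩ := Int.even_or_odd' n
  · refine absurd (hs k ?_) ?_
    · rw [Set.uIcc_of_le hn0.le]
      constructor <;> omega
    · rw [hχ', hc']
      push_cast
      rw [mul_div_cancel_left₀ _ (two_ne_zero' ℝ), sub_self]
      exact h0
  · refine ⟨hζ, ?_⟩
    have := hs k (by rw [Set.uIcc_of_le hn0.le]; constructor <;> omega)
    rw [hχ', hc', ← sub_smul] at this
    convert this using 2
    push_cast
    ring

omit hΦ in
/-- The Cartan numbers `2 B(η, β) / B(β, β)` of a halvable root `η` are even integers. -/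
lemma exists_int_of_mem_halvableRoots {η β : E} (hη : η ∈ halvableRoots Φ W) (hβ : β ∈ Φ) :
    ∃ m : ℤ, B η β = m * B β β := by
  obtain ⟨n, hn, -⟩ := hW β hβ _ hη.2
  refine ⟨n, ?_⟩
  rw [← hn, map_smul, LinearMap.smul_apply, smul_eq_mul]
  ring

lemma reflection_mem_halvableRoots {η β : E} (hη : η ∈ halvableRoots Φ W) (hβ : β ∈ Φ) {r : ℝ}
    (h : 2 * B η β = r * B β β) : η - r • β ∈ halvableRoots Φ W := by
  refine ⟨hΦ.reflection_mem hη.1 hβ h, ?_⟩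
  obtain ⟨n, hn, hs⟩ := hW β hβ _ hη.2
  have hp := hΦ.pos_of_mem hβ
  rw [map_smul, LinearMap.smul_apply, smul_eq_mul] at hn
  have hr : r = 2 * n := by
    have : (r - 2 * n) * B β β = 0 := by linarith
    rcases mul_eq_zero.mp this with h | h <;> linarith
  convert hs n (by simp) using 1
  rw [hr, smul_sub, smul_smul]
  congr 2
  ring

lemma neg_mem_halvableRoots {η : E} (hη : η ∈ halvableRoots Φ W) : -η ∈ halvableRoots Φ W := by
  have := hΦ.reflection_mem_halvableRoots hW hη hη.1 (r := 2) rfl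
  rwa [two_smul, sub_add_cancel_left] at this

include h0

/-- If `η / 2` were a root, its string through the element `η / 2` of `W` would contain `0`. -/
lemma half_notMem {η : E} (hη : η ∈ halvableRoots Φ W) : (1 / 2 : ℝ) • η ∉ Φ := by
  intro h
  obtain ⟨n, hn, hs⟩ := hW _ h _ hη.2
  have hp := hΦ.pos_of_mem h
  obtain rfl : n = 2 := by
    have : ((n : ℝ) - 2) * B ((1 / 2 : ℝ) • η) ((1 / 2 : ℝ) • η) = 0 := by linarith
    have : (n : ℝ) = 2 := by rcases mul_eq_zero.mp this with h | h <;> linarith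
    exact_mod_cast this
  have := hs 1 (by rw [Set.uIcc_of_le (by norm_num)]; constructor <;> norm_num)
  rw [Int.cast_one, one_smul, sub_self] at this
  exact h0 this

/-- A root that is not orthogonal to a halvable root `η` is `± η`, or has Cartan numbers `± 2` and
`± 1` with `η`. -/
lemma eq_or_eq_neg_or_exists_sign {η β : E} (hη : η ∈ halvableRoots Φ W) (hβ : β ∈ Φ)
    (h : B η β ≠ 0) : β = η ∨ β = -η ∨
      ∃ s : ℝ, (s = 1 ∨ s = -1) ∧ B η β = s * B β β ∧ 2 * B η β = s * B η η := by
  obtain ⟨m, hm⟩ := exists_int_of_mem_halvableRoots hW hη hβ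
  obtain ⟨n, hn, -⟩ := hΦ.string η hη.1 β (Set.mem_insert_of_mem _ hβ)
  rw [hΦ.symm β η] at hn
  have ha := hΦ.pos_of_mem hη.1
  have hb := hΦ.pos_of_mem hβ
  obtain ⟨hcs, hcs'⟩ := hΦ.sq_le_mul η (hΦ.ne_zero hβ)
  have hprod : 2 * (B η β) ^ 2 = (m * n : ℝ) * (B η η * B β β) := by
    linear_combination (B η β) * hn + n * B η η * hm
  have hab : 0 < B η η * B β β := by positivity
  have hpos : 0 < m * n := by
    have : (0 : ℝ) < m * n := by
      have h2 : 0 < (m * n : ℝ) * (B η η * B β β) := by rw [← hprod]; positivity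
      exact (mul_pos_iff_of_pos_right hab).mp h2
    exact_mod_cast this
  have hle : m * n ≤ 2 := by
    have : (m * n : ℝ) ≤ 2 := by
      refine le_of_mul_le_mul_right ?_ hab
      linarith
    exact_mod_cast this
  -- In the second case `η = m β` with `m = ± 1` or `m = ± 2`, and `m = ± 2` would make `η / 2` a
  -- root.
  obtain h1 | h2 : m * n = 1 ∨ m * n = 2 := by omega
  · right; right
    rcases Int.mul_eq_one_iff_eq_one_or_neg_one.mp h1 with ⟨rfl, rfl⟩ | ⟨rfl, rfl⟩
    · exact ⟨1, Or.inl rfl, by simpa using hm, by simpa using hn⟩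
    · exact ⟨-1, Or.inr rfl, by simpa using hm, by simpa using hn⟩
  · have heq : η = (m : ℝ) • β := by
      have h3 : (m * n : ℝ) = 2 := by exact_mod_cast h2
      have := hcs' (by rw [h3] at hprod; linarith)
      rw [hm, mul_comm, mul_smul] at this
      exact smul_right_injective E hb.ne' this
    have hm2 : m ∣ 2 := ⟨n, h2.symm⟩
    have hle2 : m ≤ 2 := Int.le_of_dvd (by norm_num) hm2
    have hge2 : -2 ≤ m := by
      have := Int.le_of_dvd (by norm_num) ((neg_dvd).mpr hm2)
      omega
    have hhalf := hΦ.half_notMem hW h0 hη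
    interval_cases m
    · refine absurd (hΦ.neg_mem hβ) ?_
      convert hhalf using 2
      rw [heq, smul_smul]
      norm_num
    · right; left
      rw [heq]; simp
    · omega
    · left
      rw [heq]; simp
    · refine absurd hβ ?_
      convert hhalf using 2
      rw [heq, smul_smul]
      norm_num

/-- In rank at least two, a halvable root `ζ` is the sum of two roots `α` and `ζ - α` that are not
halvable, with `ζ + α` not a root and Cartan number `2 B(ζ, α) / B(α, α) = 2`. -/
lemma exists_sub_mem [FiniteDimensional ℝ E] (hr : 2 ≤ Module.finrank ℝ E) {ζ : E}
    (hζ : ζ ∈ halvableRoots Φ W) :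
    ∃ α ∈ Φ, α ∉ halvableRoots Φ W ∧ ζ - α ∈ Φ ∧ ζ - α ∉ halvableRoots Φ W ∧ ζ + α ∉ Φ ∧
      B ζ α = B α α := by
  have ha := hΦ.pos_of_mem hζ.1
  obtain ⟨β, hβ, hβ1, hβ2, hβ3⟩ : ∃ β ∈ Φ, β ≠ ζ ∧ β ≠ -ζ ∧ B ζ β ≠ 0 := by
    by_contra! hcon
    have := hΦ.eq_of_orthogonal {ζ, -ζ} ?_ ⟨ζ, by simp⟩ ?_
    · have hs := hΦ.span_eq_top
      rw [← this] at hs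
      have hle : Submodule.span ℝ {ζ, -ζ} ≤ Submodule.span ℝ {ζ} := by
        rw [Submodule.span_le]
        rintro x (rfl | rfl)
        · exact Submodule.mem_span_singleton_self _
        · exact Submodule.neg_mem _ (Submodule.mem_span_singleton_self _)
      rw [hs, top_le_iff] at hle
      have := finrank_span_singleton (K := ℝ) (hΦ.ne_zero hζ.1)
      rw [hle, finrank_top] at this
      omega
    · rintro x (rfl | rfl)
      · exact hζ.1
      · exact hΦ.neg_mem hζ.1
    · rintro x hx β ⟨hβ, hβ'⟩
      simp only [Set.mem_insert_iff, Set.mem_singleton_iff, not_or] at hβ'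
      have := hcon β hβ hβ'.1 hβ'.2
      rcases hx with rfl | rfl
      · exact this
      · simp [this]
  -- One of `β` and `-β` has positive inner product with `ζ`.
  obtain ⟨α, hα, hα1, hα2⟩ : ∃ α ∈ Φ, B ζ α = B α α ∧ 2 * B ζ α = B ζ ζ := by
    rcases hΦ.eq_or_eq_neg_or_exists_sign hW h0 hζ hβ hβ3 with h | h | ⟨s, rfl | rfl, h1, h2⟩
    · exact absurd h hβ1
    · exact absurd h hβ2
    · exact ⟨β, hβ, by linarith, by linarith⟩
    · refine ⟨-β, hΦ.neg_mem hβ, ?_, ?_⟩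
      · simp only [map_neg, LinearMap.neg_apply]
        linarith
      · simp only [map_neg]
        linarith
  -- A halvable root has even Cartan number `2 B(β, ζ) / B(ζ, ζ)`.
  have hodd : ∀ β : E, 2 * B β ζ = B ζ ζ → β ∉ halvableRoots Φ W := by
    intro β h hβ
    obtain ⟨m, hm⟩ := exists_int_of_mem_halvableRoots hW hβ hζ.1
    rw [hm] at h
    have h' : ((2 * m - 1 : ℤ) : ℝ) * B ζ ζ = 0 := by push_cast; linarith
    rcases mul_eq_zero.mp h' with h' | h'
    · have : 2 * m - 1 = 0 := by exact_mod_cast h'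
      omega
    · linarith
  have hne : ζ - α ≠ 0 := by
    intro h
    rw [← sub_eq_zero.mp h] at hα2
    linarith
  refine ⟨α, hα, hodd α (by rw [hΦ.symm, hα2]), ?_, hodd _ ?_, ?_, hα1⟩
  · obtain ⟨n, hn, hs⟩ := hΦ.string α hα ζ (Set.mem_insert_of_mem _ hζ.1)
    obtain rfl : n = 2 := by
      have hp := hΦ.pos_of_mem hα
      have : ((n : ℝ) - 2) * B α α = 0 := by linarith
      have : (n : ℝ) = 2 := by rcases mul_eq_zero.mp this with h | h <;> linarith
      exact_mod_cast this
    have := hs 1 (by rw [Set.uIcc_of_le (by norm_num)]; constructor <;> norm_num)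
    rw [Int.cast_one, one_smul] at this
    exact this.resolve_left hne
  · rw [map_sub, LinearMap.sub_apply, hΦ.symm α]
    linarith
  · intro h
    have hB : B ζ (ζ + α) = B ζ ζ + B ζ α := map_add _ _ _
    rcases hΦ.eq_or_eq_neg_or_exists_sign hW h0 hζ h (by rw [hB]; linarith) with
      h | h | ⟨s, rfl | rfl, h1, h2⟩
    · exact hΦ.ne_zero hα (by simpa using h)
    · rw [h, map_neg] at hB
      linarith
    · linarith
    · linarith

lemma eq_or_eq_neg_or_orthogonal {η η' : E} (hη : η ∈ halvableRoots Φ W)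
    (hη' : η' ∈ halvableRoots Φ W) : η' = η ∨ η' = -η ∨ B η η' = 0 := by
  by_cases h : B η η' = 0
  · exact Or.inr (Or.inr h)
  rcases hΦ.eq_or_eq_neg_or_exists_sign hW h0 hη hη'.1 h with h | h | ⟨s, hs, -, h2⟩
  · exact Or.inl h
  · exact Or.inr (Or.inl h)
  · exfalso
    obtain ⟨m, hm⟩ := exists_int_of_mem_halvableRoots hW hη' hη.1
    have ha := hΦ.pos_of_mem hη.1
    rw [hΦ.symm η, hm] at h2
    have : (2 * m - s) * B η η = 0 := by linarith
    have h3 : 2 * m - s = 0 := by rcases mul_eq_zero.mp this with h | h <;> linarith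
    rcases hs with rfl | rfl
    · have : 2 * m - 1 = 0 := by exact_mod_cast h3
      omega
    · have : 2 * m - (-1) = 0 := by exact_mod_cast h3
      omega

omit hW h0 in
/-- The reflection of `(η + η') / 2` in `η'`. -/
lemma half_sub_mem {η η' : E} (hη' : η' ∈ Φ) (ho : B η η' = 0)
    (h : (1 / 2 : ℝ) • (η + η') ∈ Φ) : (1 / 2 : ℝ) • (η - η') ∈ Φ := by
  have := hΦ.reflection_mem h hη' (r := 1) (by
    simp only [map_smul, map_add, LinearMap.smul_apply, LinearMap.add_apply, ho, smul_eq_mul]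
    ring)
  convert this using 1
  module

/-- Being linked by the root `(η + η') / 2` is a transitive relation on halvable roots: reflect
`(η₁ + η₂) / 2` in `(η₂ - η₃) / 2`. -/
lemma half_add_mem_trans {η₁ η₂ η₃ : E} (h2 : η₂ ∈ halvableRoots Φ W)
    (h3 : η₃ ∈ Φ) (h12 : B η₁ η₂ = 0) (h13 : B η₁ η₃ = 0)
    (h23 : B η₂ η₃ = 0) (h : (1 / 2 : ℝ) • (η₁ + η₂) ∈ Φ) (h' : (1 / 2 : ℝ) • (η₂ + η₃) ∈ Φ) :
    (1 / 2 : ℝ) • (η₁ + η₃) ∈ Φ := by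
  have hγ := hΦ.half_sub_mem h3 h23 h'
  have hp2 := hΦ.pos_of_mem h2.1
  have hp3 := hΦ.pos_of_mem h3
  have h32 : B η₃ η₂ = 0 := by rw [hΦ.symm, h23]
  have e1 : B η₂ ((1 / 2 : ℝ) • (η₂ - η₃)) = 1 / 2 * B η₂ η₂ := by
    simp [h23]
  have e2 : B ((1 / 2 : ℝ) • (η₂ - η₃)) ((1 / 2 : ℝ) • (η₂ - η₃))
      = 1 / 4 * (B η₂ η₂ + B η₃ η₃) := by
    simp only [map_smul, map_sub, LinearMap.smul_apply, LinearMap.sub_apply, h23, h32, smul_eq_mul]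
    ring
  -- Comparing Cartan numbers shows that `η₂` and `η₃` have the same length.
  have e3 : B η₂ η₂ = B η₃ η₃ := by
    rcases hΦ.eq_or_eq_neg_or_exists_sign hW h0 h2 hγ (by rw [e1]; positivity) with
      h | h | ⟨s, rfl | rfl, h1, h2⟩
    · rw [h] at e1; linarith
    · rw [h, map_neg] at e1; linarith
    · linarith
    · linarith
  have := hΦ.reflection_mem h hγ (r := 1) (by
    rw [e2, ← e3]
    simp only [map_smul, map_add, map_sub, LinearMap.smul_apply, LinearMap.add_apply, h12, h13, h23,
      smul_eq_mul]
    ring)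
  convert this using 1
  module

/-- A root system with a halvable root `ζ` is of type `C`: the vectors `e_i` are the halves of those
halvable roots `η` that are linked to `ζ` by a root `(ζ + η) / 2`, one from each pair `± η`. -/
theorem exists_equiv_rootSystemC [FiniteDimensional ℝ E] (hr : 2 ≤ Module.finrank ℝ E) {ζ : E}
    (hζ : ζ ∈ halvableRoots Φ W) :
    ∃ l : ℕ, 2 ≤ l ∧ ∃ e : (Fin l → ℝ) ≃ₗ[ℝ] E, e '' rootSystemC l = Φ := by
  set A : Set E := {η ∈ halvableRoots Φ W | η = -ζ ∨ (1 / 2 : ℝ) • (ζ + η) ∈ Φ} with hA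
  have half_self : ∀ η : E, (1 / 2 : ℝ) • (η + η) = η := fun η => by module
  have hζA : ζ ∈ A := ⟨hζ, Or.inr (by rw [half_self]; exact hζ.1)⟩
  have hnegζ : -ζ ∈ A := ⟨hΦ.neg_mem_halvableRoots hW hζ, Or.inl rfl⟩
  have hlink : ∀ η ∈ A, η ≠ ζ → η ≠ -ζ → B ζ η = 0 ∧ (1 / 2 : ℝ) • (ζ + η) ∈ Φ := by
    rintro η ⟨hη, h⟩ h1 h2
    exact ⟨((hΦ.eq_or_eq_neg_or_orthogonal hW h0 hζ hη).resolve_left h1).resolve_left h2,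
      h.resolve_left h2⟩
  -- Any two elements of `A` are linked.
  have hpair : ∀ η ∈ A, ∀ η' ∈ A, η' ≠ η → η' ≠ -η → (1 / 2 : ℝ) • (η + η') ∈ Φ := by
    intro η hη η' hη' h1 h2
    have ho := ((hΦ.eq_or_eq_neg_or_orthogonal hW h0 hη.1 hη'.1).resolve_left h1).resolve_left h2
    by_cases e1 : η = ζ
    · subst e1
      exact (hlink η' hη' h1 h2).2
    by_cases e2 : η = -ζ
    · subst e2
      rw [neg_neg] at h2
      obtain ⟨h3, h4⟩ := hlink η' hη' h2 h1
      have := hΦ.neg_mem (hΦ.half_sub_mem hη'.1.1 h3 h4)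
      convert this using 1
      module
    obtain ⟨h3, h4⟩ := hlink η hη e1 e2
    by_cases e3 : η' = ζ
    · subst e3
      rwa [add_comm]
    by_cases e4 : η' = -ζ
    · subst e4
      have := hΦ.half_sub_mem hζ.1 (by rw [hΦ.symm, h3]) (by rwa [add_comm] at h4)
      rwa [sub_eq_add_neg] at this
    obtain ⟨h5, h6⟩ := hlink η' hη' e3 e4
    exact hΦ.half_add_mem_trans hW h0 hζ hη'.1.1 (by rw [hΦ.symm, h3]) ho h5
      (by rwa [add_comm]) h6
  -- A root that is not orthogonal to `A` is a combination of elements of `A`.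
  have hform : ∀ β ∈ Φ, ∀ η ∈ A, B η β ≠ 0 → β = η ∨ β = -η ∨
      ∃ η' ∈ A, η' ≠ η ∧ η' ≠ -η ∧ ∃ s : ℝ, (s = 1 ∨ s = -1) ∧ β = (s / 2) • (η - η') := by
    intro β hβ η hη h
    rcases hΦ.eq_or_eq_neg_or_exists_sign hW h0 hη.1 hβ h with h | h | ⟨s, hs, h1, h2⟩
    · exact Or.inl h
    · exact Or.inr (Or.inl h)
    right; right
    have hp := hΦ.pos_of_mem hβ
    have hp' := hΦ.pos_of_mem hη.1.1
    have hss : s * s = 1 := by rcases hs with rfl | rfl <;> norm_num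
    have hη' := hΦ.reflection_mem_halvableRoots hW hη.1 hβ (r := 2 * s) (by linarith)
    have hβ' : β = (s / 2) • (η - (η - (2 * s) • β)) := by
      rw [sub_sub_cancel, smul_smul]
      have : s / 2 * (2 * s) = 1 := by linarith
      rw [this, one_smul]
    have n1 : η - (2 * s) • β ≠ η := by
      intro h
      rw [h, sub_self, smul_zero] at hβ'
      exact hΦ.ne_zero hβ hβ'
    have n2 : η - (2 * s) • β ≠ -η := by
      intro h
      have : β = s • η := by
        rw [h] at hβ'
        rw [hβ']
        module
      rw [this, map_smul, smul_eq_mul] at h2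
      have h3 : s * B η η = 0 := by linarith
      rcases mul_eq_zero.mp h3 with h | h
      · rw [h] at hss; norm_num at hss
      · linarith
    have ho := ((hΦ.eq_or_eq_neg_or_orthogonal hW h0 hη.1 hη').resolve_left n1).resolve_left n2
    refine ⟨η - (2 * s) • β, ⟨hη', ?_⟩, n1, n2, s, hs, hβ'⟩
    generalize η - (2 * s) • β = η' at *
    by_cases e3 : η' = -ζ
    · exact Or.inl e3
    right
    by_cases e4 : η' = ζ
    · rw [e4, half_self]; exact hζ.1
    have hsub : (1 / 2 : ℝ) • (η - η') ∈ Φ := by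
      rcases hs with rfl | rfl
      · rwa [← hβ']
      · have := hΦ.neg_mem hβ
        rw [hβ'] at this
        convert this using 1
        module
    have hadd : (1 / 2 : ℝ) • (η + η') ∈ Φ := by
      have := hΦ.half_sub_mem (hΦ.neg_mem hη'.1) (η := η) (by rw [map_neg, ho, neg_zero])
        (by rwa [← sub_eq_add_neg])
      rwa [sub_neg_eq_add] at this
    by_cases e1 : η = ζ
    · rwa [← e1]
    by_cases e2 : η = -ζ
    · have := hΦ.neg_mem hsub
      convert this using 1
      rw [e2]
      module
    obtain ⟨h3, h4⟩ := hlink η hη e1 e2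
    have ho' := ((hΦ.eq_or_eq_neg_or_orthogonal hW h0 hζ hη').resolve_left e4).resolve_left e3
    exact hΦ.half_add_mem_trans hW h0 hη.1 hη'.1 h3 ho' ho h4 hadd
  have hspanA : ∀ β ∈ Φ, ∀ η ∈ A, B η β ≠ 0 → β ∈ Submodule.span ℝ A := by
    intro β hβ η hη h
    have hη' := Submodule.subset_span (R := ℝ) hη
    rcases hform β hβ η hη h with rfl | rfl | ⟨η', h1, -, -, s, -, rfl⟩
    · exact hη'
    · exact Submodule.neg_mem _ hη'
    · exact Submodule.smul_mem _ _ (Submodule.sub_mem _ hη' (Submodule.subset_span h1))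
  have hall : ∀ β ∈ Φ, ∃ η ∈ A, B η β ≠ 0 := by
    have := hΦ.eq_of_orthogonal {β ∈ Φ | ∃ η ∈ A, B η β ≠ 0} (fun _ h => h.1)
      ⟨ζ, hζ.1, ζ, hζA, (hΦ.pos_of_mem hζ.1).ne'⟩ ?_
    · intro β hβ
      rw [← this] at hβ
      exact hβ.2
    · rintro α ⟨hα, η, hη, hηα⟩ β ⟨hβ, hβ'⟩
      have hβ'' : ∀ η ∈ A, B η β = 0 := by
        intro η hη
        by_contra h
        exact hβ' ⟨hβ, η, hη, h⟩
      have hs := hspanA α hα η hη hηα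
      have hle : Submodule.span ℝ A ≤ LinearMap.ker (B.flip β) := Submodule.span_le.mpr hβ''
      exact hle hs
  have htop : Submodule.span ℝ A = ⊤ := by
    rw [eq_top_iff, ← hΦ.span_eq_top, Submodule.span_le]
    intro β hβ
    obtain ⟨η, hη, h⟩ := hall β hβ
    exact hspanA β hβ η hη h
  obtain ⟨S, hSA, hS, hli⟩ := exists_linearIndependent ℝ A
  rw [htop] at hS
  let b₀ : Module.Basis S ℝ E := Module.Basis.mk hli (by rw [Subtype.range_coe, hS])
  have : Fintype S := FiniteDimensional.fintypeBasisIndex b₀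
  let b := b₀.reindex (Fintype.equivFin S)
  have hbA : ∀ i, b i ∈ A := by
    intro i
    simp only [b, Module.Basis.reindex_apply, b₀, Module.Basis.mk_apply]
    exact hSA (Subtype.coe_prop _)
  have hbne : ∀ i j, i ≠ j → b i ≠ b j := fun i j hij h => hij (b.injective h)
  have hbneg : ∀ i j, b i ≠ -b j := by
    intro i j h
    by_cases hij : i = j
    · subst hij
      have := congrArg (fun x => b.repr x i) h
      norm_num at this
    · have := congrArg (fun x => b.repr x i) h
      simp [Ne.symm hij] at this
  -- Every element of `A` is `± b i`, as it is otherwise orthogonal to the whole space.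
  have hAb : ∀ η ∈ A, ∃ i, ∃ s : ℝ, (s = 1 ∨ s = -1) ∧ η = s • b i := by
    intro η hη
    by_contra! hcon
    have horth : ∀ i, B (b i) η = 0 := by
      intro i
      rcases hΦ.eq_or_eq_neg_or_orthogonal hW h0 (hbA i).1 hη.1 with h | h | h
      · exact absurd (by rw [one_smul]; exact h) (hcon i 1 (Or.inl rfl))
      · exact absurd (by rw [neg_smul, one_smul]; exact h) (hcon i (-1) (Or.inr rfl))
      · exact h
    have hle : Submodule.span ℝ (Set.range b) ≤ LinearMap.ker (B.flip η) := by
      rw [Submodule.span_le]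
      rintro _ ⟨i, rfl⟩
      exact horth i
    rw [b.span_eq] at hle
    have : B η η = 0 := hle (Submodule.mem_top (x := η))
    exact (hΦ.pos_of_mem hη.1.1).ne' this
  let e : (Fin (Fintype.card S) → ℝ) ≃ₗ[ℝ] E :=
    b.equivFun.symm.trans (LinearEquiv.smulOfNeZero ℝ E (1 / 2) (by norm_num))
  have he : ∀ i s, e (Pi.single i s) = (s / 2) • b i := by
    intro i s
    have : e (Pi.single i s) = (1 / 2 : ℝ) • ∑ j, (Pi.single i s : _ → ℝ) j • b j := by
      simp only [e, LinearEquiv.trans_apply, Module.Basis.equivFun_symm_apply]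
      rfl
    rw [this, Finset.sum_eq_single i (fun j _ hj => by simp [hj]) (by simp), Pi.single_eq_same,
      smul_smul]
    congr 1
    ring
  have hsign : ∀ (s : ℝ) (x : E), (s = 1 ∨ s = -1) → x ∈ A → s • x ∈ A := by
    rintro s x (rfl | rfl) hx
    · rwa [one_smul]
    · rw [neg_smul, one_smul]
      refine ⟨hΦ.neg_mem_halvableRoots hW hx.1, ?_⟩
      by_cases h1 : x = ζ
      · left; rw [h1]
      by_cases h2 : x = -ζ
      · right; rw [h2, neg_neg, half_self]; exact hζ.1
      obtain ⟨h3, h4⟩ := hlink x hx h1 h2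
      right
      rw [← sub_eq_add_neg]
      exact hΦ.half_sub_mem hx.1.1 h3 h4
  refine ⟨Fintype.card S, ?_, e, ?_⟩
  · rwa [← Module.finrank_eq_card_basis b₀]
  ext β
  constructor
  · rintro ⟨v, hv, rfl⟩
    rcases hv with ⟨i, j, hij, s, t, hs, ht, rfl⟩ | ⟨i, s, hs, rfl⟩
    · rw [map_add, he, he]
      have := hpair _ (hsign s _ hs (hbA i)) _ (hsign t _ ht (hbA j)) ?_ ?_
      · convert this using 1
        module
      · have := hbne i j hij
        have := hbneg j i
        have := hbneg i j
        rcases hs with rfl | rfl <;> rcases ht with rfl | rfl <;> simp <;> grind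
      · have := hbne i j hij
        have := hbneg j i
        have := hbneg i j
        rcases hs with rfl | rfl <;> rcases ht with rfl | rfl <;> simp <;> grind
    · rw [he, mul_div_cancel_left₀ _ (two_ne_zero' ℝ)]
      exact (hsign s _ hs (hbA i)).1.1
  · intro hβ
    obtain ⟨η, hη, h⟩ := hall β hβ
    obtain ⟨i, s, hs, hi⟩ := hAb η hη
    rcases hform β hβ η hη h with rfl | rfl | ⟨η', h1, h2, h3, u, hu, rfl⟩
    · refine ⟨_, Or.inr ⟨i, s, hs, rfl⟩, ?_⟩
      rw [he, hi]
      module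
    · refine ⟨_, Or.inr ⟨i, -s, by rcases hs with rfl | rfl <;> simp, rfl⟩, ?_⟩
      rw [he, hi]
      module
    · obtain ⟨j, t, ht, hj⟩ := hAb η' h1
      refine ⟨_, Or.inl ⟨i, j, ?_, u * s, -(u * t), ?_, ?_, rfl⟩, ?_⟩
      · rintro rfl
        rw [hi, hj] at h2 h3
        rcases hs with rfl | rfl <;> rcases ht with rfl | rfl <;> simp at h2 h3
      · rcases hs with rfl | rfl <;> rcases hu with rfl | rfl <;> simp
      · rcases ht with rfl | rfl <;> rcases hu with rfl | rfl <;> simp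
      · rw [map_add, he, he, hi, hj]
        module

end IsIrreducibleRootSet

end Strings

/-! ### Joint eigenspaces of symmetric operators -/

section JointEigenspaces

/-- Simultaneous diagonalization of commuting operators that are symmetric for a positive definite
form, for spaces that do not carry an inner product structure. -/
lemma iSup_iInf_eigenspace_eq_top_of_form {E ι : Type*} [AddCommGroup E] [Module ℝ E]
    [FiniteDimensional ℝ E] (B : LinearMap.BilinForm ℝ E) (hs : ∀ x y, B x y = B y x)
    (hp : ∀ x, x ≠ 0 → 0 < B x x) (T : ι → Module.End ℝ E)
    (hT : ∀ i x y, B (T i x) y = B x (T i y)) (hc : ∀ i j, Commute (T i) (T j)) :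
    ⨆ χ : ι → ℝ, ⨅ i, Module.End.eigenspace (T i) (χ i) = ⊤ := by
  let c : InnerProductSpace.Core ℝ E :=
    { inner := fun x y => B x y
      conj_inner_symm := fun x y => hs y x
      re_inner_nonneg := fun x => by
        by_cases h : x = 0
        · simp [h]
        · exact (hp x h).le
      add_left := fun x y z => by simp
      smul_left := fun x y r => by simp
      definite := fun x hx => by
        by_contra h
        exact (hp x h).ne' hx }
  let _ : NormedAddCommGroup E := c.toNormedAddCommGroup
  let _ : InnerProductSpace ℝ E := InnerProductSpace.ofCore c.toCore
  exact LinearMap.IsSymmetric.iSup_iInf_eq_top_of_commute (T := T)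
    (fun i x y => hT i x y) (fun i j _ => hc i j)

end JointEigenspaces

/-! ### Restricted weight spaces and `sl₂`-strings -/

section WeightSpaces

variable {L : Type*} [LieRing L] [LieAlgebra ℝ L] {𝔞 : LieSubalgebra ℝ L}
variable {V : Type*} [AddCommGroup V] [Module ℝ V] [LieRingModule L V] [LieModule ℝ L V]

lemma mem_weightSpace {χ : Module.Dual ℝ 𝔞} {v : V} :
    v ∈ weightSpace 𝔞 V χ ↔ ∀ H : 𝔞, ⁅(H : L), v⁆ = χ H • v := by
  simp [weightSpace, Submodule.mem_iInf]

lemma mem_weights {χ : Module.Dual ℝ 𝔞} :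
    χ ∈ weights 𝔞 V ↔ ∃ v ∈ weightSpace 𝔞 V χ, v ≠ 0 := by
  rw [weights, Set.mem_ofPred_eq, Submodule.ne_bot_iff]

lemma mem_rootSpace {ζ : Module.Dual ℝ 𝔞} {x : L} :
    x ∈ rootSpace 𝔞 ζ ↔ ∀ H : 𝔞, ⁅(H : L), x⁆ = ζ H • x :=
  mem_weightSpace

lemma mem_roots {ζ : Module.Dual ℝ 𝔞} : ζ ∈ roots 𝔞 ↔ ∃ x ∈ rootSpace 𝔞 ζ, x ≠ 0 :=
  mem_weights

lemma lie_mem_weightSpace {ζ χ : Module.Dual ℝ 𝔞} {x : L} {v : V} (hx : x ∈ rootSpace 𝔞 ζ)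
    (hv : v ∈ weightSpace 𝔞 V χ) : ⁅x, v⁆ ∈ weightSpace 𝔞 V (χ + ζ) := by
  rw [mem_weightSpace] at hv ⊢
  rw [mem_rootSpace] at hx
  intro H
  rw [leibniz_lie, hx, hv, smul_lie, lie_smul, ← add_smul, add_comm, LinearMap.add_apply]

lemma toEnd_pow_mem_weightSpace {ζ χ : Module.Dual ℝ 𝔞} {x : L} {v : V} (hx : x ∈ rootSpace 𝔞 ζ)
    (hv : v ∈ weightSpace 𝔞 V χ) (k : ℕ) :
    (LieModule.toEnd ℝ L V x ^ k) v ∈ weightSpace 𝔞 V (χ + (k : ℝ) • ζ) := by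
  induction k with
  | zero => simpa using hv
  | succ k ih =>
    rw [pow_succ', Module.End.mul_apply, LieModule.toEnd_apply_apply]
    have : χ + ((k + 1 : ℕ) : ℝ) • ζ = χ + (k : ℝ) • ζ + ζ := by
      push_cast
      module
    rw [this]
    exact lie_mem_weightSpace hx ih

/-- The `sl₂`-string through a restricted weight `χ`: it is obtained by lowering a primitive vector
of weight `χ + p ζ`, where `e ^ p v` is the last non-zero vector among the `e ^ k v`. -/
lemma exists_forall_mem_weights [FiniteDimensional ℝ V] {ζ χ : Module.Dual ℝ 𝔞}
    (hχ : χ ∈ weights 𝔞 V) {h : 𝔞} {e f : L} (t : IsSl2Triple (h : L) e f)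
    (he : e ∈ rootSpace 𝔞 ζ) (hf : f ∈ rootSpace 𝔞 (-ζ)) :
    ∃ p n : ℕ, χ h + 2 * p = n ∧
      ∀ k : ℕ, k ≤ n → χ + (p : ℝ) • ζ - (k : ℝ) • ζ ∈ weights 𝔞 V := by
  obtain ⟨v, hv, hv0⟩ := mem_weights.mp hχ
  have hvh : ⁅(h : L), v⁆ = χ h • v := mem_weightSpace.mp hv h
  have hex : ∃ k : ℕ, (LieModule.toEnd ℝ L V e ^ k) v = 0 := by
    by_contra! hcon
    have hev : ∀ k : ℕ,
        Module.End.HasEigenvalue (LieModule.toEnd ℝ L V (h : L)) (χ h + 2 * k) := by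
      intro k
      refine Module.End.hasEigenvalue_of_hasEigenvector
        (x := (LieModule.toEnd ℝ L V e ^ k) v) ⟨?_, hcon k⟩
      rw [Module.End.mem_eigenspace_iff]
      exact IsSl2Triple.lie_h_pow_toEnd_e t hvh k
    refine Set.infinite_of_injective_forall_mem (f := fun k : ℕ => χ h + 2 * (k : ℝ)) ?_ hev
      (Module.End.finite_hasEigenvalue _)
    intro a b hab
    simpa using hab
  obtain ⟨p, hp, hp'⟩ := Nat.exists_not_and_succ_of_not_zero_of_exists (by simpa using hv0) hex
  have P : t.HasPrimitiveVectorWith ((LieModule.toEnd ℝ L V e ^ p) v) (χ h + 2 * p) :=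
    ⟨hp, IsSl2Triple.lie_h_pow_toEnd_e t hvh p, by rw [IsSl2Triple.lie_e_pow_toEnd_e, hp']⟩
  obtain ⟨n, hn⟩ := P.exists_nat
  refine ⟨p, n, hn, fun k hk => mem_weights.mpr ⟨_, ?_, P.pow_toEnd_f_ne_zero_of_eq_nat hn hk⟩⟩
  have := toEnd_pow_mem_weightSpace hf (toEnd_pow_mem_weightSpace he hv p) k
  rwa [smul_neg, ← sub_eq_add_neg] at this

end WeightSpaces

/-! ### Cartan involutions and maximal abelian subspaces -/

section CartanInvolution

open LieModule

variable {L : Type*} [LieRing L] [LieAlgebra ℝ L] {θ : L →ₗ⁅ℝ⁆ L} {𝔞 : LieSubalgebra ℝ L}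

lemma mem_pPart {x : L} : x ∈ pPart θ ↔ θ x = -x := by
  simp [pPart]

lemma IsMaximalAbelianIn.apply_eq_neg (h𝔞 : IsMaximalAbelianIn θ 𝔞) (H : 𝔞) :
    θ (H : L) = -(H : L) :=
  mem_pPart.mp (h𝔞.prop.2 H.2)

lemma IsMaximalAbelianIn.lie_eq_zero (h𝔞 : IsMaximalAbelianIn θ 𝔞) (H H' : 𝔞) :
    ⁅(H : L), (H' : L)⁆ = 0 := by
  have := h𝔞.prop.1
  rw [← LieSubalgebra.coe_bracket, trivial_lie_zero, ZeroMemClass.coe_zero]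

/-- By maximality, `𝔞` contains every element of `𝔭` that commutes with it. -/
lemma IsMaximalAbelianIn.mem_of_commute (h𝔞 : IsMaximalAbelianIn θ 𝔞) {x : L} (hx : θ x = -x)
    (hc : ∀ H : 𝔞, ⁅(H : L), x⁆ = 0) : x ∈ 𝔞 := by
  have key : ∀ y ∈ 𝔞.toSubmodule ⊔ Submodule.span ℝ {x}, ∀ z ∈ 𝔞.toSubmodule ⊔ Submodule.span ℝ {x},
      ⁅y, z⁆ = 0 := by
    intro y hy z hz
    obtain ⟨H, hH, _, hr, rfl⟩ := Submodule.mem_sup.mp hy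
    obtain ⟨H', hH', _, hr', rfl⟩ := Submodule.mem_sup.mp hz
    obtain ⟨r, rfl⟩ := Submodule.mem_span_singleton.mp hr
    obtain ⟨r', rfl⟩ := Submodule.mem_span_singleton.mp hr'
    have h1 : ⁅H, H'⁆ = 0 := h𝔞.lie_eq_zero ⟨H, hH⟩ ⟨H', hH'⟩
    have h2 : ⁅H, x⁆ = 0 := hc ⟨H, hH⟩
    have h3 : ⁅x, H'⁆ = 0 := by rw [← lie_skew, hc ⟨H', hH'⟩, neg_zero]
    simp [h1, h2, h3]
  let 𝔟 : LieSubalgebra ℝ L :=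
    { 𝔞.toSubmodule ⊔ Submodule.span ℝ {x} with
      lie_mem' := fun {y z} hy hz => by
        rw [key y hy z hz]
        exact Submodule.zero_mem _ }
  have hx𝔟 : x ∈ 𝔟 :=
    Submodule.mem_sup_right (S := 𝔞.toSubmodule) (Submodule.mem_span_singleton_self x)
  refine h𝔞.le_of_ge (y := 𝔟) ⟨⟨fun y z => ?_⟩, ?_⟩ ?_ hx𝔟
  · exact Subtype.ext (key y y.2 z z.2)
  · exact sup_le h𝔞.prop.2 ((Submodule.span_singleton_le_iff_mem _ _).mpr (mem_pPart.mpr hx))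
  · exact fun y hy => Submodule.mem_sup_left (S := 𝔞.toSubmodule) hy

lemma map_mem_rootSpace_neg (h𝔞 : IsMaximalAbelianIn θ 𝔞)
    {ζ : Module.Dual ℝ 𝔞} {x : L} (hx : x ∈ rootSpace 𝔞 ζ) : θ x ∈ rootSpace 𝔞 (-ζ) := by
  rw [mem_rootSpace] at hx ⊢
  intro H
  have := congrArg θ (hx H)
  rw [LieHom.map_lie, h𝔞.apply_eq_neg, neg_lie, map_smul] at this
  rw [LinearMap.neg_apply, neg_smul, ← this, neg_neg]

namespace IsCartanInvolution

variable (hθ : IsCartanInvolution θ)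
include hθ

/-- A Cartan involution as an automorphism. -/
def toLieEquiv : L ≃ₗ⁅ℝ⁆ L :=
  { θ with
    invFun := θ
    left_inv := hθ.1
    right_inv := hθ.1 }

lemma killingForm_map_map (x y : L) : killingForm ℝ L (θ x) (θ y) = killingForm ℝ L x y :=
  LieAlgebra.killingForm_of_equiv_apply hθ.toLieEquiv x y

lemma eq_zero_of_killingForm_eq_zero {x : L} (h : killingForm ℝ L x (θ x) = 0) : x = 0 := by
  by_contra hx
  exact (hθ.2 x hx).ne h

lemma isKilling : LieAlgebra.IsKilling ℝ L := by
  refine ⟨eq_bot_iff.mpr fun x hx => ?_⟩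
  rw [LieIdeal.mem_killingCompl] at hx
  refine hθ.eq_zero_of_killingForm_eq_zero ?_
  rw [traceForm_comm]
  exact hx _ (LieSubmodule.mem_top _)

lemma killingForm_pos (h𝔞 : IsMaximalAbelianIn θ 𝔞) {H : 𝔞} (hH : H ≠ 0) :
    0 < killingForm ℝ L (H : L) (H : L) := by
  have := hθ.2 H (by simpa using hH)
  rw [h𝔞.apply_eq_neg, map_neg] at this
  linarith

variable [FiniteDimensional ℝ L]

/-- The root spaces span, because `𝔞` acts by commuting operators that are symmetric for the inner
product `-B(x, θ y)`. -/
lemma iSup_rootSpace_eq_top (h𝔞 : IsMaximalAbelianIn θ 𝔞) :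
    ⨆ ζ ∈ roots 𝔞, rootSpace 𝔞 ζ = ⊤ := by
  let B : LinearMap.BilinForm ℝ L := -(killingForm ℝ L).compl₂ (θ : L →ₗ[ℝ] L)
  have hB : ∀ x y, B x y = -killingForm ℝ L x (θ y) := fun x y => rfl
  have h := iSup_iInf_eigenspace_eq_top_of_form B ?_ ?_
    (fun H : 𝔞 => LieModule.toEnd ℝ L L (H : L)) ?_ ?_
  · rw [eq_top_iff, ← h]
    refine iSup_le fun χ x hx => ?_
    have hx' : ∀ H : 𝔞, ⁅(H : L), x⁆ = χ H • x := by
      simpa [Submodule.mem_iInf, Module.End.mem_eigenspace_iff] using hx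
    by_cases hx0 : x = 0
    · rw [hx0]
      exact Submodule.zero_mem _
    let ζ : Module.Dual ℝ 𝔞 :=
      { toFun := χ
        map_add' := fun H H' => by
          refine smul_left_injective ℝ hx0 ?_
          simp only
          rw [add_smul, ← hx', ← hx', ← hx', ← add_lie]
          rfl
        map_smul' := fun r H => by
          refine smul_left_injective ℝ hx0 ?_
          simp only [RingHom.id_apply, smul_eq_mul]
          rw [mul_smul, ← hx', ← hx', ← smul_lie]
          rfl }
    have hxζ : x ∈ rootSpace 𝔞 ζ := mem_rootSpace.mpr hx'
    exact Submodule.mem_iSup_of_mem ζ (Submodule.mem_iSup_of_mem (mem_roots.mpr ⟨x, hxζ, hx0⟩) hxζ)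
  · intro x y
    rw [hB, hB, ← hθ.killingForm_map_map, hθ.1, traceForm_comm]
  · intro x hx
    have := hθ.2 x hx
    rw [hB]
    linarith
  · intro H x y
    simp only [hB, toEnd_apply_apply]
    rw [LieHom.map_lie, h𝔞.apply_eq_neg, traceForm_apply_lie_apply', neg_lie, map_neg]
  · intro H H'
    ext x
    simp only [Module.End.mul_apply, toEnd_apply_apply]
    rw [leibniz_lie, h𝔞.lie_eq_zero, zero_lie, zero_add]

/-- The Killing form is positive definite on `𝔞`, hence identifies `𝔞` with its dual. -/
lemma exists_dual_equiv (h𝔞 : IsMaximalAbelianIn θ 𝔞) :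
    ∃ t : Module.Dual ℝ 𝔞 ≃ₗ[ℝ] 𝔞, ∀ ζ (H : 𝔞), killingForm ℝ L (t ζ : L) (H : L) = ζ H := by
  let K : 𝔞 →ₗ[ℝ] Module.Dual ℝ 𝔞 :=
    (killingForm ℝ L).domRestrict₁₂ 𝔞.toSubmodule 𝔞.toSubmodule
  have hK : ∀ H H' : 𝔞, K H H' = killingForm ℝ L (H : L) (H' : L) := fun _ _ => rfl
  have hinj : Function.Injective K := by
    rw [← LinearMap.ker_eq_bot, LinearMap.ker_eq_bot']
    intro H hH
    by_contra h0
    have := hθ.killingForm_pos h𝔞 h0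
    rw [← hK, hH] at this
    exact this.false
  let e := LinearEquiv.ofInjectiveOfFinrankEq K hinj (Subspace.dual_finrank_eq).symm
  refine ⟨e.symm, fun ζ H => ?_⟩
  rw [← hK]
  exact congrArg (fun f : Module.Dual ℝ 𝔞 => f H) (e.apply_symm_apply ζ)

end IsCartanInvolution

end CartanInvolution

/-! ### `sl₂`-triples of restricted roots -/

section RootStrings

variable {L : Type*} [LieRing L] [LieAlgebra ℝ L] {θ : L →ₗ⁅ℝ⁆ L} {𝔞 : LieSubalgebra ℝ L}

/-- The bilinear form `(ζ, ξ) ↦ ξ (t ζ)` on the dual of `𝔞`. For the `t` representing functionals by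
the Killing form, it is the form dual to the Killing form on `𝔞`. -/
def dualForm (t : Module.Dual ℝ 𝔞 ≃ₗ[ℝ] 𝔞) : LinearMap.BilinForm ℝ (Module.Dual ℝ 𝔞) :=
  (Module.Dual.eval ℝ 𝔞).comp t.toLinearMap

lemma dualForm_apply (t : Module.Dual ℝ 𝔞 ≃ₗ[ℝ] 𝔞) (ζ ξ : Module.Dual ℝ 𝔞) :
    dualForm t ζ ξ = ξ (t ζ) := rfl

variable (hθ : IsCartanInvolution θ) (h𝔞 : IsMaximalAbelianIn θ 𝔞)
  {t : Module.Dual ℝ 𝔞 ≃ₗ[ℝ] 𝔞} (ht : ∀ ζ (H : 𝔞), killingForm ℝ L (t ζ : L) (H : L) = ζ H)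

include ht in
lemma dualForm_symm (ζ ξ : Module.Dual ℝ 𝔞) : dualForm t ζ ξ = dualForm t ξ ζ := by
  rw [dualForm_apply, dualForm_apply, ← ht, ← ht, LieModule.traceForm_comm]

include hθ h𝔞 ht

lemma dualForm_pos {ζ : Module.Dual ℝ 𝔞} (hζ : ζ ≠ 0) : 0 < dualForm t ζ ζ := by
  rw [dualForm_apply, ← ht]
  exact hθ.killingForm_pos h𝔞 (by simpa using hζ)

/-- For `x ∈ 𝔤^ζ` the bracket `[x, θ x]` lies in `𝔞`, where it is the multiple `B(x, θ x) t_ζ` of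
the vector dual to `ζ`; rescaling gives an `sl₂`-triple. -/
lemma exists_isSl2Triple {ζ : Module.Dual ℝ 𝔞} (hζ : ζ ≠ 0) {x : L} (hx : x ∈ rootSpace 𝔞 ζ)
    (hx0 : x ≠ 0) :
    ∃ f ∈ rootSpace 𝔞 (-ζ), IsSl2Triple (((2 / dualForm t ζ ζ) • t ζ : 𝔞) : L) x f := by
  have hθx := map_mem_rootSpace_neg h𝔞 hx
  have hpos := dualForm_pos hθ h𝔞 ht hζ
  have hκ := hθ.2 x hx0
  have hmem : ⁅x, θ x⁆ ∈ 𝔞 := by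
    refine h𝔞.mem_of_commute ?_ fun H => ?_
    · rw [LieHom.map_lie, hθ.1, lie_skew]
    · have := mem_weightSpace.mp (lie_mem_weightSpace hx hθx) H
      simpa using this
  have heq : ⁅x, θ x⁆ = ((killingForm ℝ L x (θ x) • t ζ : 𝔞) : L) := by
    have : (⟨⁅x, θ x⁆, hmem⟩ - killingForm ℝ L x (θ x) • t ζ : 𝔞) = 0 := by
      by_contra h0
      refine (hθ.killingForm_pos h𝔞 h0).ne' ?_
      generalize hz : (⟨⁅x, θ x⁆, hmem⟩ - killingForm ℝ L x (θ x) • t ζ : 𝔞) = z at *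
      nth_rw 1 [← hz]
      have h1 : killingForm ℝ L ⁅x, θ x⁆ (z : L) = killingForm ℝ L x (θ x) * ζ z := by
        rw [LieModule.traceForm_apply_lie_apply, ← lie_skew, mem_rootSpace.mp hθx,
          LinearMap.neg_apply, neg_smul, neg_neg, map_smul, smul_eq_mul, mul_comm]
      rw [AddSubgroupClass.coe_sub, SetLike.val_smul, map_sub, map_smul, LinearMap.sub_apply,
        LinearMap.smul_apply, h1, ht, smul_eq_mul, sub_self]
    exact congrArg Subtype.val (sub_eq_zero.mp this)
  have hth : ∀ ξ : Module.Dual ℝ 𝔞, ξ ((2 / dualForm t ζ ζ) • t ζ)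
      = 2 / dualForm t ζ ζ * dualForm t ζ ξ := fun ξ => by
    rw [map_smul, smul_eq_mul, dualForm_apply t ζ ξ]
  have hζh : ζ ((2 / dualForm t ζ ζ) • t ζ) = 2 := by
    rw [hth, div_mul_cancel₀ _ hpos.ne']
  refine ⟨(2 / (dualForm t ζ ζ * killingForm ℝ L x (θ x))) • θ x, Submodule.smul_mem _ _ hθx,
    ?_, ?_, ?_, ?_⟩
  · rw [Ne, ZeroMemClass.coe_eq_zero]
    intro h
    rw [h, map_zero] at hζh
    norm_num at hζh
  · rw [lie_smul, heq]
    simp only [SetLike.val_smul, smul_smul]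
    congr 1
    have := hκ.ne
    field_simp
  · rw [mem_rootSpace.mp hx, hζh, ofNat_smul_eq_nsmul]
  · rw [lie_smul, mem_rootSpace.mp hθx, LinearMap.neg_apply, hζh, smul_comm, neg_smul,
      ofNat_smul_eq_nsmul]

variable {V : Type*} [AddCommGroup V] [Module ℝ V] [FiniteDimensional ℝ V] [LieRingModule L V]
  [LieModule ℝ L V]

variable (V) in
/-- The strings with `n ≥ 0` come from the `sl₂`-triple of `β`, those with `n ≤ 0` from that of
`-β`. -/
lemma isStringClosed_weights :
    IsStringClosed (dualForm t) (roots 𝔞 \ {0}) (weights 𝔞 V) := by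
  rintro β ⟨hβ, hβ0 : β ≠ 0⟩ χ hχ
  obtain ⟨e, he, he0⟩ := mem_roots.mp hβ
  obtain ⟨f, hf, htr⟩ := exists_isSl2Triple hθ h𝔞 ht hβ0 he he0
  have hpos := dualForm_pos hθ h𝔞 ht hβ0
  set h : 𝔞 := (2 / dualForm t β β) • t β with hh
  have hχh : χ h = 2 * dualForm t χ β / dualForm t β β := by
    rw [hh, map_smul, smul_eq_mul, dualForm_symm ht χ β, dualForm_apply t β χ]
    ring
  obtain ⟨p, n, hpn, hs⟩ := exists_forall_mem_weights hχ htr he hf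
  obtain ⟨p', n', hpn', hs'⟩ := exists_forall_mem_weights (h := -h) (ζ := -β) hχ
    (by simpa using htr.symm) hf (by rwa [neg_neg])
  refine ⟨n - 2 * p, ?_, fun k hk => ?_⟩
  · have : χ h * dualForm t β β = 2 * dualForm t χ β := by
      rw [hχh, div_mul_cancel₀ _ hpos.ne']
    rw [← this]
    congr 1
    push_cast
    linarith
  · have hrel : (n : ℤ) - 2 * p = 2 * p' - n' := by
      have : (n : ℝ) - 2 * p = 2 * p' - n' := by
        rw [map_neg] at hpn'
        linarith
      exact_mod_cast this
    rcases le_total 0 ((n : ℤ) - 2 * p) with h0 | h0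
    · rw [Set.uIcc_of_le h0] at hk
      obtain ⟨h1, h2⟩ := hk
      lift k to ℕ using h1
      convert hs (k + p) (by omega) using 1
      push_cast
      module
    · rw [Set.uIcc_of_ge h0] at hk
      obtain ⟨h1, h2⟩ := hk
      obtain ⟨j, rfl⟩ : ∃ j : ℕ, k = -(j : ℤ) := ⟨(-k).toNat, by omega⟩
      convert hs' (j + p') (by omega) using 1
      push_cast
      module

end RootStrings

/-! ### Irreducibility of the roots of a simple Lie algebra -/

section Irreducibility

variable {L : Type*} [LieRing L] [LieAlgebra ℝ L] {θ : L →ₗ⁅ℝ⁆ L} {𝔞 : LieSubalgebra ℝ L}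

lemma IsCartanInvolution.eq_zero_of_forall_lie (hθ : IsCartanInvolution θ) {x : L}
    (hx : ∀ y : L, ⁅x, y⁆ = 0) : x = 0 := by
  refine hθ.eq_zero_of_killingForm_eq_zero ?_
  have : LieAlgebra.ad ℝ L x = 0 := LinearMap.ext hx
  rw [killingForm_apply_apply, this, LinearMap.zero_comp, map_zero]

variable [FiniteDimensional ℝ L] (hθ : IsCartanInvolution θ) (h𝔞 : IsMaximalAbelianIn θ 𝔞)
include hθ h𝔞

lemma span_nonzero_roots_eq_top : Submodule.span ℝ (roots 𝔞 \ {0}) = ⊤ := by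
  by_contra hne
  obtain ⟨f, hf0, hf⟩ := Submodule.exists_le_ker_of_lt_top _ (lt_top_iff_ne_top.mpr hne)
  obtain ⟨H, rfl⟩ := (Module.evalEquiv ℝ 𝔞).surjective f
  have hH : ∀ ζ ∈ roots 𝔞, ζ H = 0 := by
    intro ζ hζ
    by_cases h0 : ζ = 0
    · rw [h0, LinearMap.zero_apply]
    · exact hf (Submodule.subset_span ⟨hζ, h0⟩)
  have hle : (⊤ : Submodule ℝ L) ≤ LinearMap.ker (LieAlgebra.ad ℝ L (H : L) : L →ₗ[ℝ] L) := by
    rw [← hθ.iSup_rootSpace_eq_top h𝔞]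
    refine iSup₂_le fun ζ hζ x hx => ?_
    rw [LinearMap.mem_ker, LieAlgebra.ad_apply, mem_rootSpace.mp hx, hH ζ hζ, zero_smul]
  have : H = 0 := Subtype.ext
    (hθ.eq_zero_of_forall_lie fun y => hle (Submodule.mem_top (x := y)))
  exact hf0 (by rw [this, map_zero])

/-- If the non-zero roots split into two mutually orthogonal sets, the elements commuting with the
root spaces of the second set form an ideal, which contains the root spaces of the first. In a
simple Lie algebra one of the two sets is therefore empty. -/
lemma eq_of_orthogonal_of_isSimple [LieAlgebra.IsSimple ℝ L] {t : Module.Dual ℝ 𝔞 ≃ₗ[ℝ] 𝔞}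
    (ht : ∀ ζ (H : 𝔞), killingForm ℝ L (t ζ : L) (H : L) = ζ H) {Ψ : Set (Module.Dual ℝ 𝔞)}
    (hΨ : Ψ ⊆ roots 𝔞 \ {0}) (hne : Ψ.Nonempty)
    (ho : ∀ α ∈ Ψ, ∀ β ∈ (roots 𝔞 \ {0}) \ Ψ, dualForm t α β = 0) : Ψ = roots 𝔞 \ {0} := by
  let C : Submodule ℝ L :=
    { carrier := {x | ∀ β ∈ (roots 𝔞 \ {0}) \ Ψ, ∀ y ∈ rootSpace 𝔞 β, ⁅x, y⁆ = 0}
      add_mem' := fun {x x'} hx hx' β hβ y hy => by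
        rw [add_lie, hx β hβ y hy, hx' β hβ y hy, add_zero]
      zero_mem' := fun β _ y _ => zero_lie y
      smul_mem' := fun r x hx β hβ y hy => by rw [smul_lie, hx β hβ y hy, smul_zero] }
  have hC : ∀ x, x ∈ C ↔ ∀ β ∈ (roots 𝔞 \ {0}) \ Ψ, ∀ y ∈ rootSpace 𝔞 β, ⁅x, y⁆ = 0 :=
    fun _ => Iff.rfl
  have hΨC : ∀ α ∈ Ψ, rootSpace 𝔞 α ≤ C := by
    intro α hα x hx
    rw [hC]
    intro β hβ y hy
    have hαβ := ho α hα β hβ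
    have hmem : ⁅x, y⁆ ∈ rootSpace 𝔞 (β + α) := lie_mem_weightSpace hx hy
    by_contra h0
    have hroot : β + α ∈ roots 𝔞 := mem_roots.mpr ⟨_, hmem, h0⟩
    have hpα := dualForm_pos hθ h𝔞 ht (hΨ hα).2
    have hpβ := dualForm_pos hθ h𝔞 ht hβ.1.2
    by_cases hz : β + α = 0
    · rw [eq_neg_of_add_eq_zero_left hz, map_neg] at hαβ
      linarith
    by_cases hin : β + α ∈ Ψ
    · have := ho _ hin β hβ
      rw [map_add, LinearMap.add_apply, hαβ] at this
      linarith
    · have := ho α hα _ ⟨⟨hroot, hz⟩, hin⟩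
      rw [map_add, hαβ] at this
      linarith
  let I : LieIdeal ℝ L :=
    { C with
      lie_mem := fun {z x} hx => by
        have hle : (⊤ : Submodule ℝ L) ≤
            C.comap ((LieModule.toEnd ℝ L L : L →ₗ[ℝ] Module.End ℝ L).flip x) := by
          rw [← hθ.iSup_rootSpace_eq_top h𝔞]
          refine iSup₂_le fun ζ hζ z hz => ?_
          change ⁅z, x⁆ ∈ C
          rw [hC]
          intro β hβ y hy
          have hxy : ⁅x, y⁆ = 0 := hx β hβ y hy
          by_cases h0 : ζ = 0
          · have hzy : ⁅z, y⁆ ∈ rootSpace 𝔞 β := by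
              have := lie_mem_weightSpace hz hy
              rwa [h0, add_zero] at this
            rw [lie_lie, hxy, lie_zero, hx β hβ _ hzy, sub_zero]
          by_cases h1 : ζ ∈ Ψ
          · rw [lie_lie, hxy, hΨC ζ h1 hz β hβ y hy, lie_zero, lie_zero, sub_zero]
          · rw [← lie_skew z x, hx ζ ⟨⟨hζ, h0⟩, h1⟩ z hz, neg_zero, zero_lie]
        exact hle (Submodule.mem_top (x := z)) }
  have hI : ∀ x, x ∈ I ↔ x ∈ C := fun _ => Iff.rfl
  refine hΨ.antisymm fun β hβ => ?_
  by_contra hβΨ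
  rcases LieAlgebra.IsSimple.eq_bot_or_eq_top (R := ℝ) I with h | h
  · obtain ⟨α, hα⟩ := hne
    obtain ⟨x, hx, hx0⟩ := mem_roots.mp (hΨ hα).1
    have : x ∈ I := hΨC α hα hx
    rw [h] at this
    exact hx0 this
  · obtain ⟨y, hy, hy0⟩ := mem_roots.mp hβ.1
    refine hy0 (hθ.eq_zero_of_forall_lie fun x => ?_)
    have hx : x ∈ I := by
      rw [h]
      exact LieSubmodule.mem_top x
    rw [← lie_skew, hx β ⟨hβ, hβΨ⟩ y hy, neg_zero]

lemma isIrreducibleRootSet_roots [LieAlgebra.IsSimple ℝ L] {t : Module.Dual ℝ 𝔞 ≃ₗ[ℝ] 𝔞}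
    (ht : ∀ ζ (H : 𝔞), killingForm ℝ L (t ζ : L) (H : L) = ζ H) :
    IsIrreducibleRootSet (dualForm t) (roots 𝔞 \ {0}) where
  symm := dualForm_symm ht
  pos _ := dualForm_pos hθ h𝔞 ht
  zero_notMem h := h.2 rfl
  span_eq_top := span_nonzero_roots_eq_top hθ h𝔞
  eq_of_orthogonal _ hΨ hne ho := eq_of_orthogonal_of_isSimple hθ h𝔞 ht hΨ hne ho
  string := by
    rintro β hβ χ (rfl | hχ)
    · refine ⟨0, by simp, fun k hk => Or.inl ?_⟩
      obtain rfl : k = 0 := by simpa using hk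
      simp
    · obtain ⟨n, hn, hs⟩ := isStringClosed_weights hθ h𝔞 ht L β hβ χ hχ.1
      refine ⟨n, hn, fun k hk => ?_⟩
      by_cases h0 : χ - (k : ℝ) • β = 0
      · exact Or.inl h0
      · exact Or.inr ⟨hs k hk, h0⟩

end Irreducibility

/-! ### Simple Lie algebras -/

section Simple

variable {L : Type*} [LieRing L] [LieAlgebra ℝ L] [FiniteDimensional ℝ L] {θ : L →ₗ⁅ℝ⁆ L}
  {𝔞 : LieSubalgebra ℝ L} (hθ : IsCartanInvolution θ) (h𝔞 : IsMaximalAbelianIn θ 𝔞)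
include hθ h𝔞

omit [FiniteDimensional ℝ L] in
lemma not_isCompactLieAlgebra {ζ : Module.Dual ℝ 𝔞} (hζ : ζ ≠ 0) : ¬ IsCompactLieAlgebra L := by
  intro hc
  obtain ⟨H, hH⟩ : ∃ H, ζ H ≠ 0 := by
    by_contra! h
    exact hζ (LinearMap.ext h)
  have hH0 : H ≠ 0 := by
    rintro rfl
    exact hH (map_zero ζ)
  have h1 := hθ.killingForm_pos h𝔞 hH0
  have h2 := hc H (by simpa using hH0)
  linarith

omit [FiniteDimensional ℝ L] in
lemma two_le_finrank_dual (hr : ¬ IsCompactLieAlgebra L → 2 ≤ realRank L)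
    {ζ : Module.Dual ℝ 𝔞} (hζ : ζ ≠ 0) : 2 ≤ Module.finrank ℝ (Module.Dual ℝ 𝔞) := by
  rw [Subspace.dual_finrank_eq]
  exact (hr (not_isCompactLieAlgebra hθ h𝔞 hζ)).trans (Nat.sInf_le ⟨θ, 𝔞, hθ, h𝔞, rfl⟩)

variable [LieAlgebra.IsSimple ℝ L] {V : Type*} [AddCommGroup V] [Module ℝ V]
  [FiniteDimensional ℝ V] [LieRingModule L V] [LieModule ℝ L V]

theorem stronglyNonresonant_of_isSimple (hr : ¬ IsCompactLieAlgebra L → 2 ≤ realRank L)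
    (hC : ¬ IsCompactLieAlgebra L → ¬ HasTypeC L) (hV : ∀ χ ∈ weights 𝔞 V, χ ≠ 0) :
    StronglyNonresonant 𝔞 V := by
  rintro ζ hζ hζ0 ⟨c, hc, χ, hχ, hζχ⟩
  obtain ⟨t, ht⟩ := hθ.exists_dual_equiv h𝔞
  have hΦ := isIrreducibleRootSet_roots hθ h𝔞 ht
  have hW := isStringClosed_weights hθ h𝔞 ht V
  have h0 : (0 : Module.Dual ℝ 𝔞) ∉ weights 𝔞 V := fun h => hV 0 h rfl
  have hmem := hΦ.mem_halvableRoots_of_eq_smul hW h0 ⟨hζ, hζ0⟩ hχ hc hζχ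
  exact hC (not_isCompactLieAlgebra hθ h𝔞 hζ0) ⟨θ, 𝔞, hθ, h𝔞,
    hΦ.exists_equiv_rootSystemC hW h0 (two_le_finrank_dual hθ h𝔞 hr hζ0) hmem⟩

/-- A resonant root `ζ` is a sum of two non-resonant roots `α` and `ζ - α`, and `[𝔤^α, 𝔤^(ζ - α)]`
is all of `𝔤^ζ`. -/
theorem weaklyNonresonant_of_isSimple (hr : ¬ IsCompactLieAlgebra L → 2 ≤ realRank L)
    (hV : ∀ χ ∈ weights 𝔞 V, χ ≠ 0) : WeaklyNonresonant 𝔞 V := by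
  obtain ⟨t, ht⟩ := hθ.exists_dual_equiv h𝔞
  have hΦ := isIrreducibleRootSet_roots hθ h𝔞 ht
  have hW := isStringClosed_weights hθ h𝔞 ht V
  have h0 : (0 : Module.Dual ℝ 𝔞) ∉ weights 𝔞 V := fun h => hV 0 h rfl
  have hres : ∀ ζ ∈ roots 𝔞, ζ ≠ 0 → IsResonant 𝔞 V ζ →
      ζ ∈ halvableRoots (roots 𝔞 \ {0}) (weights 𝔞 V) := by
    rintro ζ hζ hζ0 ⟨c, hc, χ, hχ, hζχ⟩
    exact hΦ.mem_halvableRoots_of_eq_smul hW h0 ⟨hζ, hζ0⟩ hχ hc hζχ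
  unfold WeaklyNonresonant
  set S := LieSubalgebra.lieSpan ℝ L
    ((rootSpace 𝔞 0 : Set L) ∪ ⋃ ζ ∈ nonresonantRoots 𝔞 V, (rootSpace 𝔞 ζ : Set L)) with hS
  have hnr : ∀ ζ ∈ roots 𝔞, ¬ IsResonant 𝔞 V ζ → ∀ x ∈ rootSpace 𝔞 ζ, x ∈ S := by
    intro ζ hζ hζ' x hx
    exact LieSubalgebra.subset_lieSpan (Or.inr (Set.mem_biUnion ⟨hζ, hζ'⟩ hx))
  have hall : ∀ ζ ∈ roots 𝔞, rootSpace 𝔞 ζ ≤ S.toSubmodule := by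
    intro ζ hζ x hx
    by_cases hζ0 : ζ = 0
    · rw [hζ0] at hx
      exact LieSubalgebra.subset_lieSpan (Or.inl hx)
    by_cases hζr : IsResonant 𝔞 V ζ
    · obtain ⟨α, hα, hα', hβ, hβ', hadd, heq⟩ :=
        hΦ.exists_sub_mem hW h0 (two_le_finrank_dual hθ h𝔞 hr hζ0) (hres ζ hζ hζ0 hζr)
      obtain ⟨e, he, he0⟩ := mem_roots.mp hα.1
      obtain ⟨f, hf, htr⟩ := exists_isSl2Triple hθ h𝔞 ht hα.2 he he0
      have hpos := dualForm_pos hθ h𝔞 ht hα.2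
      have heS : e ∈ S := hnr α hα.1 (fun h => hα' (hres α hα.1 hα.2 h)) e he
      have hfx : ⁅f, x⁆ ∈ S := by
        refine hnr _ hβ.1 (fun h => hβ' (hres _ hβ.1 hβ.2 h)) _ ?_
        have := lie_mem_weightSpace hf hx
        rwa [← sub_eq_add_neg] at this
      have hex : ⁅e, x⁆ = 0 := by
        by_contra hne
        refine hadd ⟨mem_roots.mpr ⟨_, lie_mem_weightSpace he hx, hne⟩, ?_⟩
        intro h
        rw [eq_neg_of_add_eq_zero_left h, map_neg, LinearMap.neg_apply] at heq
        linarith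
      -- `ζ (h_α) = 2` and `[e, x] = 0`, so that `[e, [f, x]] = [h, x] = 2 x`.
      have hx2 : ⁅e, ⁅f, x⁆⁆ = (2 : ℝ) • x := by
        rw [leibniz_lie, htr.lie_e_f, hex, lie_zero, add_zero, mem_rootSpace.mp hx, map_smul,
          smul_eq_mul, ← dualForm_apply t α ζ, dualForm_symm ht α ζ, heq,
          div_mul_cancel₀ _ hpos.ne']
      have := S.smul_mem (1 / 2 : ℝ) (S.lie_mem heS hfx)
      rw [hx2, smul_smul] at this
      norm_num at this
      exact this
    · exact hnr ζ hζ hζr x hx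
  rw [← LieSubalgebra.toSubmodule_inj, LieSubalgebra.top_toSubmodule, eq_top_iff,
    ← hθ.iSup_rootSpace_eq_top h𝔞]
  exact iSup₂_le hall

end Simple

/-! ### Reduction to simple ideals -/

section Ideals

variable {L : Type*} [LieRing L] [LieAlgebra ℝ L] {θ : L →ₗ⁅ℝ⁆ L} {𝔞 : LieSubalgebra ℝ L}
  {I : LieIdeal ℝ L}

/-- A Cartan involution preserves every simple ideal: if `I ∩ θ I` vanished, so would
`B(x, θ x)` for `x ∈ I`. -/
lemma IsCartanInvolution.map_mem_of_isAtom (hθ : IsCartanInvolution θ) (hI : IsAtom I) {x : L}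
    (hx : x ∈ I) : θ x ∈ I := by
  let J : LieIdeal ℝ L :=
    { I.toSubmodule ⊓ I.toSubmodule.comap (θ : L →ₗ[ℝ] L) with
      lie_mem := fun {y z} hz => by
        refine ⟨lie_mem_right ℝ L I y z hz.1, ?_⟩
        change θ ⁅y, z⁆ ∈ I
        rw [LieHom.map_lie]
        exact lie_mem_right ℝ L I _ _ hz.2 }
  have hJ : ∀ y, y ∈ J ↔ y ∈ I ∧ θ y ∈ I := fun _ => Iff.rfl
  rcases hI.le_iff.mp (show J ≤ I from fun y hy => hy.1) with h | h
  · refine absurd ((LieSubmodule.eq_bot_iff _).mpr fun y hy => ?_) hI.1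
    refine hθ.eq_zero_of_killingForm_eq_zero ?_
    have : LieAlgebra.ad ℝ L y ∘ₗ LieAlgebra.ad ℝ L (θ y) = 0 := by
      ext z
      have hz : ⁅y, ⁅θ y, z⁆⁆ ∈ J := by
        refine (hJ _).mpr ⟨lie_mem_left ℝ L I _ _ hy, ?_⟩
        rw [LieHom.map_lie, LieHom.map_lie, hθ.1]
        exact lie_mem_right ℝ L I _ _ (lie_mem_left ℝ L I _ _ hy)
      rw [h] at hz
      exact hz
    rw [killingForm_apply_apply, this, map_zero]
  · rw [← h] at hx
    exact hx.2

/-- `π` is the projection of `L` onto the ideal `I` along a complementary ideal that is stable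
under `θ`. It is treated as a linear map from `L` to itself; that the kernel commutes with `I` is
the field `lie_left`. -/
structure IsIdealProjection (θ : L →ₗ⁅ℝ⁆ L) (I : LieIdeal ℝ L) (π : L →ₗ[ℝ] L) : Prop where
  mem : ∀ x, π x ∈ I
  apply_of_mem : ∀ x ∈ I, π x = x
  map_lie : ∀ x y : L, π ⁅x, y⁆ = ⁅x, π y⁆
  map_involution : ∀ x, π (θ x) = θ (π x)
  lie_left : ∀ x : L, ∀ y ∈ I, ⁅π x, y⁆ = ⁅x, y⁆

lemma IsCartanInvolution.exists_isIdealProjection [FiniteDimensional ℝ L]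
    (hθ : IsCartanInvolution θ) (hI : IsAtom I) : ∃ π, IsIdealProjection θ I π := by
  have := hθ.isKilling
  have hc := I.isCompl_killingCompl
  have hc' : IsCompl I.toSubmodule I.killingCompl.toSubmodule :=
    LieSubmodule.isCompl_toSubmodule.mpr hc
  let π : L →ₗ[ℝ] L :=
    I.toSubmodule.subtype ∘ₗ I.toSubmodule.projectionOnto I.killingCompl.toSubmodule hc'
  have h1 : ∀ x, π x ∈ I := fun x => Subtype.coe_prop _
  have h2 : ∀ x ∈ I, π x = x := fun x hx =>
    congrArg Subtype.val (Submodule.projectionOnto_apply_left hc' ⟨x, hx⟩)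
  have h3 : ∀ x ∈ I.killingCompl, π x = 0 := fun x hx =>
    congrArg Subtype.val (Submodule.projectionOnto_apply_right hc' ⟨x, hx⟩)
  have h4 : ∀ x, x - π x ∈ I.killingCompl := by
    intro x
    obtain ⟨y, hy, z, hz, rfl⟩ := Submodule.mem_sup.mp
      (hc'.sup_eq_top ▸ Submodule.mem_top (x := x))
    rw [map_add, h2 y hy, h3 z hz, add_zero, add_sub_cancel_left]
    exact hz
  have h5 : ∀ y ∈ I, ∀ z ∈ I.killingCompl, π (y + z) = y := by
    intro y hy z hz
    rw [map_add, h2 y hy, h3 z hz, add_zero]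
  refine ⟨π, h1, h2, fun x y => ?_, fun x => ?_, fun x y hy => ?_⟩
  · have := h5 ⁅x, π y⁆ (lie_mem_right ℝ L I _ _ (h1 y)) ⁅x, y - π y⁆
      (lie_mem_right ℝ L I.killingCompl _ _ (h4 y))
    rwa [← lie_add, add_sub_cancel] at this
  · have := h5 (θ (π x)) (hθ.map_mem_of_isAtom hI (h1 x)) (θ (x - π x)) ?_
    · rwa [← map_add, add_sub_cancel] at this
    · rw [LieIdeal.mem_killingCompl]
      intro y hy
      rw [← hθ.killingForm_map_map, hθ.1]
      exact (I.mem_killingCompl ℝ L).mp (h4 x) _ (hθ.map_mem_of_isAtom hI hy)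
  · have hmem : ⁅x - π x, y⁆ ∈ I ⊓ I.killingCompl :=
      ⟨lie_mem_right ℝ L I _ _ hy, lie_mem_left ℝ L I.killingCompl _ _ (h4 x)⟩
    rw [hc.inf_eq_bot, LieSubmodule.mem_bot, sub_lie] at hmem
    exact (sub_eq_zero.mp hmem).symm

/-- The restriction of an endomorphism to an ideal that it preserves. -/
def restrictIdeal (θ : L →ₗ⁅ℝ⁆ L) (I : LieIdeal ℝ L) (h : ∀ x ∈ I, θ x ∈ I) : I →ₗ⁅ℝ⁆ I where
  toFun x := ⟨θ x, h x x.2⟩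
  map_add' _ _ := Subtype.ext (map_add θ _ _)
  map_smul' r _ := Subtype.ext (map_smul θ r _)
  map_lie' := Subtype.ext (LieHom.map_lie θ _ _)

lemma IsCartanInvolution.restrictIdeal [FiniteDimensional ℝ L] (hθ : IsCartanInvolution θ)
    (h : ∀ x ∈ I, θ x ∈ I) : IsCartanInvolution (restrictIdeal θ I h) := by
  refine ⟨fun x => Subtype.ext (hθ.1 x), fun x hx => ?_⟩
  rw [LieIdeal.killingForm_eq]
  exact hθ.2 x (by simpa using hx)

/-- The intersection of `𝔞` with an ideal, as a subalgebra of the ideal. -/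
def interIdeal (𝔞 : LieSubalgebra ℝ L) (I : LieIdeal ℝ L) : LieSubalgebra ℝ I :=
  𝔞.comap I.incl

lemma mem_interIdeal {x : I} : x ∈ interIdeal 𝔞 I ↔ (x : L) ∈ 𝔞 := Iff.rfl

namespace IsIdealProjection

variable {π : L →ₗ[ℝ] L} (hπ : IsIdealProjection θ I π) (h𝔞 : IsMaximalAbelianIn θ 𝔞)
include hπ h𝔞

/-- `𝔞` is stable under the projection, as `π H` lies in `𝔭` and commutes with `𝔞`. -/
lemma apply_mem {x : L} (hx : x ∈ 𝔞) : π x ∈ 𝔞 := by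
  refine h𝔞.mem_of_commute ?_ fun H => ?_
  · rw [← hπ.map_involution, h𝔞.apply_eq_neg ⟨x, hx⟩, map_neg]
  · rw [← hπ.map_lie, h𝔞.lie_eq_zero H ⟨x, hx⟩, map_zero]

/-- `𝔞 ∩ I` is maximal abelian in `𝔭 ∩ I`: an element of `I` commuting with `𝔞 ∩ I` commutes with
`𝔞`, since the complementary component of `𝔞` commutes with `I`. -/
lemma isMaximalAbelianIn (h : ∀ x ∈ I, θ x ∈ I) :
    IsMaximalAbelianIn (restrictIdeal θ I h) (interIdeal 𝔞 I) := by
  refine ⟨⟨⟨fun x y => ?_⟩, fun x hx => ?_⟩, fun 𝔟 h𝔟 hle x hx => ?_⟩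
  · exact Subtype.ext (Subtype.ext (h𝔞.lie_eq_zero ⟨_, x.2⟩ ⟨_, y.2⟩))
  · rw [mem_pPart]
    exact Subtype.ext (h𝔞.apply_eq_neg ⟨_, hx⟩)
  · rw [mem_interIdeal]
    refine h𝔞.mem_of_commute ?_ fun H => ?_
    · exact congrArg Subtype.val (mem_pPart.mp (h𝔟.2 hx))
    · rw [← hπ.lie_left H x x.2]
      have hH : (⟨π H, hπ.mem H⟩ : I) ∈ 𝔟 := hle (hπ.apply_mem h𝔞 H.2)
      have := h𝔟.1.trivial ⟨_, hH⟩ ⟨x, hx⟩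
      exact congrArg Subtype.val (congrArg Subtype.val this)

/-- The projection of `𝔞` onto `𝔞 ∩ I`. -/
def projInter : 𝔞 →ₗ[ℝ] interIdeal 𝔞 I where
  toFun H := ⟨⟨π H, hπ.mem H⟩, hπ.apply_mem h𝔞 H.2⟩
  map_add' _ _ := Subtype.ext (Subtype.ext (map_add π _ _))
  map_smul' r _ := Subtype.ext (Subtype.ext (map_smul π r _))

lemma mem_rootSpace_comp_projInter {ζ : Module.Dual ℝ (interIdeal 𝔞 I)} {x : I}
    (hx : x ∈ rootSpace (interIdeal 𝔞 I) ζ) :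
    (x : L) ∈ rootSpace 𝔞 (ζ ∘ₗ hπ.projInter h𝔞) := by
  rw [mem_rootSpace] at hx ⊢
  intro H
  rw [← hπ.lie_left H x x.2]
  exact congrArg Subtype.val (hx (hπ.projInter h𝔞 H))

end IsIdealProjection

variable {V : Type*} [AddCommGroup V] [Module ℝ V] [LieRingModule L V] [LieModule ℝ L V]
variable {π : L →ₗ[ℝ] L}

variable (𝔞 V) in
/-- The vectors of `V` annihilated by the part of `𝔞` complementary to `𝔞 ∩ I`; they form a
representation of the ideal `I`. -/
def IsIdealProjection.invariants (hπ : IsIdealProjection θ I π) : LieSubmodule ℝ I V where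
  carrier := {v | ∀ H ∈ 𝔞, π H = 0 → ⁅H, v⁆ = 0}
  add_mem' {v w} hv hw H hH h := by rw [lie_add, hv H hH h, hw H hH h, add_zero]
  zero_mem' H _ _ := lie_zero H
  smul_mem' r v hv H hH h := by rw [lie_smul, hv H hH h, smul_zero]
  lie_mem {x v} hv H hH h := by
    change ⁅H, ⁅(x : L), v⁆⁆ = 0
    rw [leibniz_lie, ← hπ.lie_left H x x.2, h, zero_lie, zero_lie, zero_add, hv H hH h, lie_zero]

namespace IsIdealProjection

variable (hπ : IsIdealProjection θ I π) (h𝔞 : IsMaximalAbelianIn θ 𝔞)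
include hπ h𝔞

lemma comp_projInter_mem_weights {χ : Module.Dual ℝ (interIdeal 𝔞 I)}
    (hχ : χ ∈ weights (interIdeal 𝔞 I) (hπ.invariants 𝔞 V)) :
    χ ∘ₗ hπ.projInter h𝔞 ∈ weights 𝔞 V := by
  obtain ⟨v, hv, hv0⟩ := mem_weights.mp hχ
  refine mem_weights.mpr ⟨v, mem_weightSpace.mpr fun H => ?_, by simpa using hv0⟩
  have h1 : ⁅π H, (v : V)⁆ = χ (hπ.projInter h𝔞 H) • (v : V) :=
    congrArg Subtype.val (mem_weightSpace.mp hv (hπ.projInter h𝔞 H))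
  have h2 : ⁅(H : L) - π H, (v : V)⁆ = 0 :=
    v.2 _ (𝔞.sub_mem H.2 (hπ.apply_mem h𝔞 H.2))
      (by rw [map_sub, hπ.apply_of_mem _ (hπ.mem H), sub_self])
  rw [sub_lie, sub_eq_zero] at h2
  rw [h2, h1, LinearMap.comp_apply]

/-- If a functional on `𝔞 ∩ I`, extended by zero, is resonant with `V`, then it is resonant with
the representation `invariants` of `I`: the weight vectors in `V` lie in this subspace. -/
lemma isResonant_invariants {ζ : Module.Dual ℝ (interIdeal 𝔞 I)}
    (h : IsResonant 𝔞 V (ζ ∘ₗ hπ.projInter h𝔞)) :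
    IsResonant (interIdeal 𝔞 I) (hπ.invariants 𝔞 V) ζ := by
  obtain ⟨c, hc, χ, hχ, hζχ⟩ := h
  obtain ⟨v, hv, hv0⟩ := mem_weights.mp hχ
  rw [mem_weightSpace] at hv
  have hχζ : ∀ H, χ H = c⁻¹ * ζ (hπ.projInter h𝔞 H) := fun H => by
    have : ζ (hπ.projInter h𝔞 H) = c * χ H := LinearMap.congr_fun hζχ H
    rw [this, inv_mul_cancel_left₀ hc.ne']
  have hvU : v ∈ hπ.invariants 𝔞 V := by
    intro H hH h0
    have h1 : hπ.projInter h𝔞 ⟨H, hH⟩ = 0 := Subtype.ext (Subtype.ext h0)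
    have := hv ⟨H, hH⟩
    rwa [hχζ, h1, map_zero, mul_zero, zero_smul] at this
  refine ⟨c, hc, c⁻¹ • ζ, mem_weights.mpr ⟨⟨v, hvU⟩, mem_weightSpace.mpr fun H => ?_, ?_⟩, ?_⟩
  · have hH : hπ.projInter h𝔞 ⟨((H : I) : L), H.2⟩ = H :=
      Subtype.ext (Subtype.ext (hπ.apply_of_mem _ (H : I).2))
    refine Subtype.ext ((hv ⟨((H : I) : L), H.2⟩).trans ?_)
    rw [hχζ, hH]
    rfl
  · intro h
    exact hv0 (congrArg Subtype.val h)
  · rw [smul_smul, mul_inv_cancel₀ hc.ne', one_smul]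

end IsIdealProjection

lemma eq_top_of_forall_isAtom_le [LieAlgebra.IsSemisimple ℝ L] (N : Submodule ℝ L)
    (h : ∀ I : LieIdeal ℝ L, IsAtom I → I.toSubmodule ≤ N) : N = ⊤ := by
  have := congrArg LieSubmodule.toSubmodule (LieAlgebra.IsSemisimple.sSup_atoms_eq_top (R := ℝ)
    (L := L))
  rw [LieSubmodule.sSup_toSubmodule, LieSubmodule.top_toSubmodule] at this
  rw [eq_top_iff, ← this]
  refine sSup_le ?_
  rintro _ ⟨I, hI, rfl⟩
  exact h I hI

end Ideals

end RestrictedRoots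

/-! ### Weak and strong non-resonance -/

theorem mainTheorem9
    {L : Type*} [LieRing L] [LieAlgebra ℝ L] [FiniteDimensional ℝ L]
    [LieAlgebra.IsSemisimple ℝ L]
    (hrank : ∀ I : LieIdeal ℝ L, LieAlgebra.IsSimple ℝ I →
      ¬ RestrictedRoots.IsCompactLieAlgebra I → 2 ≤ RestrictedRoots.realRank I)
    (θ : L →ₗ⁅ℝ⁆ L) (hθ : RestrictedRoots.IsCartanInvolution θ)
    (𝔞 : LieSubalgebra ℝ L) (h𝔞 : RestrictedRoots.IsMaximalAbelianIn θ 𝔞)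
    {V : Type*} [AddCommGroup V] [Module ℝ V] [FiniteDimensional ℝ V]
    [LieRingModule L V] [LieModule ℝ L V]
    (hV : ∀ χ ∈ RestrictedRoots.weights 𝔞 V, χ ≠ 0) :
    RestrictedRoots.WeaklyNonresonant 𝔞 V ∧
    ((∀ I : LieIdeal ℝ L, LieAlgebra.IsSimple ℝ I →
        ¬ RestrictedRoots.IsCompactLieAlgebra I → ¬ RestrictedRoots.HasTypeC I) →
      RestrictedRoots.StronglyNonresonant 𝔞 V) := by
  open RestrictedRoots in
  have hinv : ∀ (I : LieIdeal ℝ L) {π : L →ₗ[ℝ] L} (hπ : IsIdealProjection θ I π),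
      ∀ χ ∈ weights (interIdeal 𝔞 I) (hπ.invariants 𝔞 V), χ ≠ 0 := by
    rintro I π hπ χ hχ rfl
    exact hV _ (hπ.comp_projInter_mem_weights h𝔞 hχ) (LinearMap.zero_comp _)
  refine ⟨?_, fun hC => ?_⟩
  · unfold WeaklyNonresonant
    rw [← LieSubalgebra.toSubmodule_inj, LieSubalgebra.top_toSubmodule]
    refine eq_top_of_forall_isAtom_le _ fun I hI x hx => ?_
    obtain ⟨π, hπ⟩ := hθ.exists_isIdealProjection hI
    have hsimple := LieAlgebra.IsSemisimple.isSimple_of_isAtom I hI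
    have hmap : ∀ x ∈ I, θ x ∈ I := fun x hx => hθ.map_mem_of_isAtom hI hx
    have hw := weaklyNonresonant_of_isSimple (hθ.restrictIdeal hmap)
      (hπ.isMaximalAbelianIn h𝔞 hmap) (hrank I hsimple) (hinv I hπ)
    set S := LieSubalgebra.lieSpan ℝ L
      ((rootSpace 𝔞 0 : Set L) ∪ ⋃ ζ ∈ nonresonantRoots 𝔞 V, (rootSpace 𝔞 ζ : Set L)) with hS
    have hle : (⊤ : LieSubalgebra ℝ I) ≤ S.comap I.incl := by
      rw [← hw, LieSubalgebra.lieSpan_le]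
      rintro y (hy | hy)
      · have := hπ.mem_rootSpace_comp_projInter h𝔞 hy
        rw [LinearMap.zero_comp] at this
        exact LieSubalgebra.subset_lieSpan (Or.inl this)
      · obtain ⟨ζ, hζ, hy⟩ := Set.mem_iUnion₂.mp hy
        refine LieSubalgebra.subset_lieSpan (Or.inr (Set.mem_biUnion
          (x := ζ ∘ₗ hπ.projInter h𝔞) ⟨?_, fun h => hζ.2 (hπ.isResonant_invariants h𝔞 h)⟩
          (hπ.mem_rootSpace_comp_projInter h𝔞 hy)))
        obtain ⟨z, hz, hz0⟩ := mem_roots.mp hζ.1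
        exact mem_roots.mpr ⟨z, hπ.mem_rootSpace_comp_projInter h𝔞 hz, by simpa using hz0⟩
    exact hle (LieSubalgebra.mem_top (⟨x, hx⟩ : I))
  · intro ζ hζ hζ0 hres
    obtain ⟨x, hx, hx0⟩ := mem_roots.mp hζ
    -- Some simple ideal has a non-zero component of the root vector `x`, as `x` is not central.
    obtain ⟨I, hI, y, hy, hyx⟩ : ∃ I : LieIdeal ℝ L, IsAtom I ∧ ∃ y ∈ I, ⁅x, y⁆ ≠ 0 := by
      by_contra! hcon
      have := eq_top_of_forall_isAtom_le (LinearMap.ker (LieAlgebra.ad ℝ L x : L →ₗ[ℝ] L)) hcon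
      exact hx0 (hθ.eq_zero_of_forall_lie fun y =>
        (this ▸ Submodule.mem_top (x := y) : y ∈ LinearMap.ker (LieAlgebra.ad ℝ L x : L →ₗ[ℝ] L)))
    obtain ⟨π, hπ⟩ := hθ.exists_isIdealProjection hI
    have hsimple := LieAlgebra.IsSemisimple.isSimple_of_isAtom I hI
    have hmap : ∀ x ∈ I, θ x ∈ I := fun x hx => hθ.map_mem_of_isAtom hI hx
    have hs := stronglyNonresonant_of_isSimple (hθ.restrictIdeal hmap)
      (hπ.isMaximalAbelianIn h𝔞 hmap) (hrank I hsimple) (hC I hsimple) (hinv I hπ)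
    have hπx : π x ≠ 0 := by
      intro h
      rw [← hπ.lie_left x y hy, h, zero_lie] at hyx
      exact hyx rfl
    have hlie : ∀ H : 𝔞, ⁅(H : L), π x⁆ = ζ H • π x := fun H => by
      rw [← hπ.map_lie, mem_rootSpace.mp hx, map_smul]
    let ι : interIdeal 𝔞 I →ₗ[ℝ] 𝔞 :=
      { toFun := fun H => ⟨((H : I) : L), H.2⟩
        map_add' := fun _ _ => rfl
        map_smul' := fun _ _ => rfl }
    -- `H` and `π H` act in the same way on `π x`, so that `ζ` is the extension by zero of its
    -- restriction to `𝔞 ∩ I`.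
    have hζ' : (ζ ∘ₗ ι) ∘ₗ hπ.projInter h𝔞 = ζ := by
      ext H
      refine smul_left_injective ℝ hπx ?_
      change ζ ⟨π H, hπ.apply_mem h𝔞 H.2⟩ • π x = ζ H • π x
      rw [← hlie, ← hlie]
      exact hπ.lie_left H _ (hπ.mem x)
    refine hs (ζ ∘ₗ ι) (mem_roots.mpr ⟨⟨π x, hπ.mem x⟩, mem_rootSpace.mpr fun H => ?_, ?_⟩) ?_
      (hπ.isResonant_invariants h𝔞 (by rwa [hζ']))
    · exact Subtype.ext (hlie (ι H))
    · intro h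
      exact hπx (congrArg Subtype.val h)
    · intro h
      rw [h, LinearMap.zero_comp] at hζ'
      exact hζ0 hζ'.symm
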